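/- Let $K$ be a global field, that is, a finite extension of $\mathbb{Q}$ or of $\mathbb{F}_p(t)$ for some prime $p$. Let $\mathbb{A}_K=\mathbb{A}_\infty\times\mathbb{A}_f$ be its adele ring, where $\mathbb{A}_\infty=\prod_{v\mid\infty}K_v$ (a finite product of copies of $\mathbb{R}$ and $\mathbb{C}$, which is $0$ if $K$ is a function field) and $\mathbb{A}_f$ is the restricted product of the completions $K_v$ at the finite places. Let $|\cdot|:\mathbb{A}_K^\times\to\mathbb{R}_{>0}$ be the idele norm, the product of the normalized absolute values of the components (the square of the usual absolute value at complex places). Let $\mathcal{S}(\mathbb{A}_K)$ be the space of Bruhat-Schwartz functions on $\mathbb{A}_K$: the functions $f:\mathbb{A}_\infty\times\mathbb{A}_f\to\mathbb{C}$ that vanish outside $\mathbb{A}_\infty\times C$ for some compact $C\subseteq\mathbb{A}_f$, are invariant under translation by some open subgroup $U$ of $\mathbb{A}_f$, and restrict to Schwartz functions on $\mathbb{A}_\infty\times\{y\}$ for all $y\in\mathbb{A}_f$. A subset of $\mathcal{S}(\mathbb{A}_K)$ is bounded if $C$ and $U$ can be chosen the same for all its elements and if, for each $y$, the restrictions of its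 elements to $\mathbb{A}_\infty\times\{y\}$ form a von Neumann bounded subset of the Fréchet space $\mathcal{S}(\mathbb{A}_\infty)$. Let $\Lambda\mathbb{A}_\infty$ be the exterior algebra of the real vector space $\mathbb{A}_\infty$, a finite-dimensional space with its usual bornology, and equip $\mathcal{S}(\mathbb{A}_K)\hat\otimes\Lambda\mathbb{A}_\infty=\mathcal{S}(\mathbb{A}_K)\otimes_{\mathbb{R}}\Lambda\mathbb{A}_\infty$ with the projective tensor product bornology. Let $\rho$ be the representation of $\mathbb{A}_K^\times$ on $\mathcal{S}(\mathbb{A}_K)$ given by $(\rho_gf)(x)=|g|\,f(xg)$. Let $\pi$ be the representation of $\mathbb{A}_K^\times$ on $\Lambda\mathbb{A}_\infty$ that is induced by the multiplication action of $\mathbb{A}_\infty^\times$ on $\mathbb{A}_\infty$ and on which $\mathbb{A}_f^\times$ acts trivially. **Lemma 4.1.** There exists a bornological isomorphism $\Phi$ of $\mathcal{S}(\mathbb{A}_K)\hat\otimes\Lambda\mathbb{A}_\infty$, that is, a $\mathbb{C}$-linear bijection such that a subset $T$ is bounded if and only if $\Phi(T)$ is bounded, that intertwines the representations $\rho\hat\otimes\pi$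 and $\rho\hat\otimes\mathrm{id}$ of $\mathbb{A}_K^\times$: $$\Phi\circ(\rho_g\otimes\pi_g)=(\rho_g\otimes\mathrm{id})\circ\Phi\qquad\text{for all } g\in\mathbb{A}_K^\times.$$ -/

import Mathlib

open scoped TensorProduct SchwartzMap NNReal RestrictedProduct

noncomputable section

namespace GlobalAdele

/-- A global field: a finite extension of `ℚ` (an algebraic number field) or of `𝔽_p(t)` for some
prime `p` (a global function field). -/
class IsGlobalField (K : Type*) [Field K] : Prop where
  numberField_or_functionField :
    NumberField K ∨ ∃ (p : ℕ) (_ : Fact p.Prime) (_ : Algebra (RatFunc (ZMod p)) K),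
      FunctionField (ZMod p) K

/-! ### Infinite places -/

section Infinite

open NumberField

/-- A number field has finitely many infinite places. A function field has none, because it has
positive characteristic and so does not embed into `ℂ`. -/
instance finite_infinitePlace (K : Type*) [Field K] [h : IsGlobalField K] :
    Finite (InfinitePlace K) := by
  rcases h.numberField_or_functionField with h | ⟨p, hp, hA, -⟩
  · infer_instance
  · have : CharP (RatFunc (ZMod p)) p := charP_of_injective_algebraMap
      (algebraMap (ZMod p) (RatFunc (ZMod p))).injective p
    have : CharP K p := charP_of_injective_algebraMap
      (algebraMap (RatFunc (ZMod p)) K).injective p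
    have hempty : IsEmpty (InfinitePlace K) := by
      refine ⟨fun w => ?_⟩
      obtain ⟨φ, -⟩ := w.2
      have : CharP ℂ p := charP_of_injective_ringHom φ.injective p
      exact hp.out.ne_zero (CharP.eq ℂ this (CharP.ofCharZero ℂ))
    infer_instance

instance fintype_infinitePlace (K : Type*) [Field K] [IsGlobalField K] :
    Fintype (InfinitePlace K) := Fintype.ofFinite _

instance fintype_realPlace (K : Type*) [Field K] [IsGlobalField K] :
    Fintype {w : InfinitePlace K // w.IsReal} := Fintype.ofFinite _

instance fintype_complexPlace (K : Type*) [Field K] [IsGlobalField K] :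
    Fintype {w : InfinitePlace K // w.IsComplex} := Fintype.ofFinite _

/-- The infinite adele ring `𝔸_∞ = ∏_{v ∣ ∞} K_v`, where `K_v` is `ℝ` at the real and `ℂ` at the
complex places; it is the zero ring for a function field. -/
abbrev InfAdele (K : Type*) [Field K] : Type _ := mixedEmbedding.mixedSpace K

end Infinite

/-! ### Finite places -/

/-- A finite place of `K`, given by its valuation ring in `K`: a discrete valuation ring with
quotient field `K` and finite residue field. These correspond to the dense embeddings of `K` into
non-Archimedean local fields, up to equivalence. -/
structure FinPlace (K : Type*) [Field K] where
  ring : ValuationSubring K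
  isDVR : IsDiscreteValuationRing ring
  finite_residueField : Finite (IsLocalRing.ResidueField ring)

namespace FinPlace

variable {K : Type*} [Field K] (v : FinPlace K)

instance : IsDiscreteValuationRing v.ring := v.isDVR

instance : Finite (IsLocalRing.ResidueField v.ring) := v.finite_residueField

instance : IsPrincipalIdealRing v.ring := v.isDVR.toIsPrincipalIdealRing

instance : IsDedekindDomain v.ring := IsPrincipalIdealRing.isDedekindDomain v.ring

instance : IsFractionRing v.ring K := inferInstance

/-- The maximal ideal of the valuation ring of `v`. -/
def prime : IsDedekindDomain.HeightOneSpectrum v.ring :=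
  IsDiscreteValuationRing.maximalIdeal v.ring

/-- The local field `K_v`. -/
abbrev LocalField : Type _ := v.prime.adicCompletion K

/-- The ring of integers `O_v` of `K_v`. -/
abbrev LocalIntegers : ValuationSubring v.LocalField := v.prime.adicCompletionIntegers K

/-- The number of elements of the residue field. -/
def residueCard : ℕ := Nat.card (IsLocalRing.ResidueField v.ring)

lemma residueCard_ne_zero : (v.residueCard : ℝ≥0) ≠ 0 := by
  have : v.residueCard ≠ 0 := Nat.card_pos.ne'
  exact_mod_cast this

/-- The canonical norm on the local field `K_v`: it sends `x ≠ 0` to `q ^ (-ord_v x)`, where `q` is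
the number of elements of the residue field. -/
def localNorm : v.LocalField →*₀ ℝ≥0 :=
  (WithZeroMulInt.toNNReal v.residueCard_ne_zero).comp
    (Valued.v : Valuation v.LocalField (WithZero (Multiplicative ℤ))).toMonoidWithZeroHom

end FinPlace

/-! ### Adeles and ideles -/

/-- The finite adele ring `𝔸_f`: the restricted product of the `K_v` with respect to the `O_v`,
over all finite places `v`. -/
abbrev FinAdele (K : Type*) [Field K] : Type _ :=
  Πʳ v : FinPlace K, [v.LocalField, v.LocalIntegers]

/-- The adele ring `𝔸_K = 𝔸_∞ × 𝔸_f`. -/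
abbrev Adele (K : Type*) [Field K] : Type _ := InfAdele K × FinAdele K

instance (K : Type*) [Field K] :
    Fact (∀ v : FinPlace K, IsOpen (v.LocalIntegers : Set v.LocalField)) :=
  ⟨fun _ => Valued.isOpen_valuationSubring _⟩

section IdeleNorm

variable {K : Type*} [Field K]

lemma mulSupport_localNorm_finite (g : (FinAdele K)ˣ) :
    (Function.mulSupport fun v : FinPlace K => v.localNorm ((g : FinAdele K) v)).Finite := by
  have h1 := (g : FinAdele K).eventually
  have h2 := ((g⁻¹ : (FinAdele K)ˣ) : FinAdele K).eventually
  rw [Filter.eventually_cofinite] at h1 h2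
  refine (h1.union h2).subset fun v hv => ?_
  by_contra hcon
  simp only [Set.mem_union, Set.mem_ofPred_eq, not_or, not_not] at hcon
  obtain ⟨ha, hb⟩ := hcon
  apply hv
  have hmul : (g : FinAdele K) v * ((g⁻¹ : (FinAdele K)ˣ) : FinAdele K) v = 1 := by
    rw [← RestrictedProduct.mul_apply, Units.mul_inv, RestrictedProduct.one_apply]
  have hval := congrArg
    (Valued.v : Valuation v.LocalField (WithZero (Multiplicative ℤ))) hmul
  rw [map_mul, map_one] at hval
  have ha' : Valued.v ((g : FinAdele K) v) ≤ (1 : WithZero (Multiplicative ℤ)) := ha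
  have hb' : Valued.v (((g⁻¹ : (FinAdele K)ˣ) : FinAdele K) v)
      ≤ (1 : WithZero (Multiplicative ℤ)) := hb
  have h1' : Valued.v ((g : FinAdele K) v) = (1 : WithZero (Multiplicative ℤ)) := by
    refine le_antisymm ha' ?_
    calc (1 : WithZero (Multiplicative ℤ)) = _ := hval.symm
      _ ≤ Valued.v ((g : FinAdele K) v) * 1 := mul_le_mul_right hb' _
      _ = _ := mul_one _
  change WithZeroMulInt.toNNReal v.residueCard_ne_zero (Valued.v ((g : FinAdele K) v)) = 1
  rw [h1', map_one]

/-- The norm of a finite idele, the product of the local norms (almost all of which are `1`). -/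
def finIdeleNorm : (FinAdele K)ˣ →* ℝ where
  toFun g := ((∏ᶠ v : FinPlace K, v.localNorm ((g : FinAdele K) v) : ℝ≥0) : ℝ)
  map_one' := by simp
  map_mul' g h := by
    rw [← NNReal.coe_mul, ← finprod_mul_distrib (mulSupport_localNorm_finite g)
      (mulSupport_localNorm_finite h)]
    simp

variable [IsGlobalField K]

/-- The norm of an infinite adele: the product of the absolute values at the real places and of the
squares of the absolute values at the complex places. -/
def infNorm : InfAdele K →* ℝ where
  toFun x := (∏ w, |x.1 w|) * ∏ w, ‖x.2 w‖ ^ 2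
  map_one' := by simp
  map_mul' x y := by
    simp only [Prod.fst_mul, Prod.snd_mul, Pi.mul_apply, abs_mul, norm_mul, mul_pow,
      Finset.prod_mul_distrib]
    ring

/-- The norm homomorphism `|·|` on the idele group, the product of all local norms. -/
def ideleNorm : (Adele K)ˣ →* ℝ where
  toFun g := infNorm (g : Adele K).1 *
    finIdeleNorm (Units.map (RingHom.snd (InfAdele K) (FinAdele K) : Adele K →* FinAdele K) g)
  map_one' := by simp
  map_mul' g h := by
    simp only [Units.val_mul, Prod.fst_mul, map_mul]
    ring

end IdeleNorm

/-! ### The Bruhat-Schwartz space and its bornology -/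

section BruhatSchwartz

variable {K : Type*} [Field K] [IsGlobalField K]

/-- `f` is supported in `𝔸_∞ × C`, is invariant under translation by the subgroup `U` of `𝔸_f`, and
restricts to a Schwartz function on each copy `𝔸_∞ × {y}` of the real vector space `𝔸_∞`. -/
structure IsBruhatSchwartz (C : Set (FinAdele K)) (U : OpenAddSubgroup (FinAdele K))
    (f : Adele K → ℂ) : Prop where
  support : ∀ x, ∀ y ∉ C, f (x, y) = 0
  invariant : ∀ x y, ∀ u ∈ U, f (x, y + u) = f (x, y)
  schwartz : ∀ y, ∃ φ : 𝓢(InfAdele K, ℂ), ∀ x, φ x = f (x, y)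

lemma IsBruhatSchwartz.mono {C C' : Set (FinAdele K)} {U U' : OpenAddSubgroup (FinAdele K)}
    {f : Adele K → ℂ} (h : IsBruhatSchwartz C U f) (hC : C ⊆ C') (hU : U' ≤ U) :
    IsBruhatSchwartz C' U' f :=
  ⟨fun x y hy => h.support x y fun hy' => hy (hC hy'),
    fun x y u hu => h.invariant x y u (hU hu), h.schwartz⟩

variable (K) in
/-- The space `𝓢(𝔸_K)` of Bruhat-Schwartz functions on `𝔸_K`. -/
def BruhatSchwartz : Submodule ℂ (Adele K → ℂ) where
  carrier := {f | ∃ C : Set (FinAdele K), IsCompact C ∧ ∃ U : OpenAddSubgroup (FinAdele K),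
    IsBruhatSchwartz C U f}
  zero_mem' := ⟨∅, isCompact_empty, ⊤, by simp, by simp, fun _ => ⟨0, by simp⟩⟩
  add_mem' := by
    rintro f f' ⟨C, hC, U, h⟩ ⟨C', hC', U', h'⟩
    have h1 := h.mono (C' := C ∪ C') (U' := U ⊓ U') Set.subset_union_left inf_le_left
    have h2 := h'.mono (C' := C ∪ C') (U' := U ⊓ U') Set.subset_union_right inf_le_right
    refine ⟨C ∪ C', hC.union hC', U ⊓ U', fun x y hy => ?_, fun x y u hu => ?_, fun y => ?_⟩
    · simp [h1.support x y hy, h2.support x y hy]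
    · simp [h1.invariant x y u hu, h2.invariant x y u hu]
    · obtain ⟨φ, hφ⟩ := h1.schwartz y
      obtain ⟨ψ, hψ⟩ := h2.schwartz y
      exact ⟨φ + ψ, fun x => by simp [hφ, hψ]⟩
  smul_mem' := by
    rintro c f ⟨C, hC, U, h⟩
    refine ⟨C, hC, U, fun x y hy => ?_, fun x y u hu => ?_, fun y => ?_⟩
    · simp [h.support x y hy]
    · simp [h.invariant x y u hu]
    · obtain ⟨φ, hφ⟩ := h.schwartz y
      exact ⟨c • φ, fun x => by simp [hφ]⟩

lemma exists_slice (f : BruhatSchwartz K) (y : FinAdele K) :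
    ∃ φ : 𝓢(InfAdele K, ℂ), ∀ x, φ x = f.1 (x, y) := by
  obtain ⟨C, -, U, h⟩ := f.2
  exact h.schwartz y

/-- The restriction of a Bruhat-Schwartz function to `𝔸_∞ × {y}`, as a Schwartz function. -/
def slice (f : BruhatSchwartz K) (y : FinAdele K) : 𝓢(InfAdele K, ℂ) :=
  (exists_slice f y).choose

lemma slice_apply (f : BruhatSchwartz K) (y : FinAdele K) (x : InfAdele K) :
    slice f y x = f.1 (x, y) :=
  (exists_slice f y).choose_spec x

variable (K) in
/-- The canonical bornology on `𝓢(𝔸_K)`: a set is bounded if its elements are supported in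
`𝔸_∞ × C` and invariant under `U` for a common compact subset `C` and a common open subgroup `U`
of `𝔸_f`, and if their restrictions to each `𝔸_∞ × {y}` form a von Neumann bounded subset of the
Fréchet space `𝓢(𝔸_∞)`. This is the bornology of `𝓢(𝔸_f) ⊗ 𝓢(𝔸_∞)` for the fine bornology
on `𝓢(𝔸_f)` and the von Neumann bornology on `𝓢(𝔸_∞)`. -/
@[reducible] def bruhatSchwartzBornology : Bornology (BruhatSchwartz K) :=
  Bornology.ofBounded
    {B | ∃ C : Set (FinAdele K), IsCompact C ∧ ∃ U : OpenAddSubgroup (FinAdele K),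
      (∀ f ∈ B, IsBruhatSchwartz C U (f : Adele K → ℂ)) ∧
        ∀ y, Bornology.IsVonNBounded ℂ ((fun f : BruhatSchwartz K => slice f y) '' B)}
    ⟨∅, isCompact_empty, ⊤, by simp, by simp⟩
    (by
      rintro B ⟨C, hC, U, h, hb⟩ B' hB
      exact ⟨C, hC, U, fun f hf => h f (hB hf), fun y => (hb y).subset (Set.image_mono hB)⟩)
    (by
      rintro B ⟨C, hC, U, h, hb⟩ B' ⟨C', hC', U', h', hb'⟩
      refine ⟨C ∪ C', hC.union hC', U ⊓ U', fun f hf => ?_, fun y => ?_⟩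
      · rcases hf with hf | hf
        · exact (h f hf).mono Set.subset_union_left inf_le_left
        · exact (h' f hf).mono Set.subset_union_right inf_le_right
      · rw [Set.image_union]
        exact (hb y).union (hb' y))
    (by
      intro f
      obtain ⟨C, hC, U, h⟩ := f.2
      refine ⟨C, hC, U, by simpa using h, fun y => ?_⟩
      rw [Set.image_singleton]
      exact Bornology.isVonNBounded_singleton _)

/-! ### The representations -/

/-- Multiplication by the infinite component of an idele, an `ℝ`-linear automorphism of `𝔸_∞`. -/
def infMul (g : (Adele K)ˣ) : InfAdele K ≃L[ℝ] InfAdele K :=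
  ContinuousLinearEquiv.equivOfInverse
    (ContinuousLinearMap.mul ℝ (InfAdele K) (g : Adele K).1)
    (ContinuousLinearMap.mul ℝ (InfAdele K) ((g⁻¹ : (Adele K)ˣ) : Adele K).1)
    (fun x => by
      rw [ContinuousLinearMap.mul_apply', ContinuousLinearMap.mul_apply', ← mul_assoc,
        ← Prod.fst_mul, Units.inv_mul, Prod.fst_one, one_mul])
    (fun x => by
      rw [ContinuousLinearMap.mul_apply', ContinuousLinearMap.mul_apply', ← mul_assoc,
        ← Prod.fst_mul, Units.mul_inv, Prod.fst_one, one_mul])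

lemma infMul_apply (g : (Adele K)ˣ) (x : InfAdele K) : infMul g x = (g : Adele K).1 * x := rfl

lemma comp_mul_mem (g : (Adele K)ˣ) {f : Adele K → ℂ} (hf : f ∈ BruhatSchwartz K) :
    (fun x => f (x * (g : Adele K))) ∈ BruhatSchwartz K := by
  obtain ⟨C, hC, U, h⟩ := hf
  set b : FinAdele K := (g : Adele K).2 with hb
  set b' : FinAdele K := ((g⁻¹ : (Adele K)ˣ) : Adele K).2 with hb'
  have hbb' : b * b' = 1 := by
    rw [hb, hb', ← Prod.snd_mul, Units.mul_inv, Prod.snd_one]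
  refine ⟨(fun y => y * b') '' C, hC.image (continuous_mul_const b'),
    U.comap (AddMonoidHom.mulRight b) (continuous_mul_const b),
    fun x y hy => ?_, fun x y u hu => ?_, fun y => ?_⟩
  · refine h.support (x * (g : Adele K).1) (y * b) fun hyb => hy ⟨y * b, hyb, ?_⟩
    change y * b * b' = y
    rw [mul_assoc, hbb', mul_one]
  · change f (x * (g : Adele K).1, (y + u) * b) = f (x * (g : Adele K).1, y * b)
    rw [add_mul]
    exact h.invariant _ _ _ hu
  · obtain ⟨φ, hφ⟩ := h.schwartz (y * b)
    refine ⟨SchwartzMap.compCLMOfContinuousLinearEquiv ℂ (infMul g) φ, fun x => ?_⟩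
    rw [SchwartzMap.compCLMOfContinuousLinearEquiv_apply, Function.comp_apply, hφ, infMul_apply,
      mul_comm]
    rfl

/-- The operator `(ρ_g f)(x) = |g| f(x g)` on `𝓢(𝔸_K)`. -/
def rhoMap (g : (Adele K)ˣ) : BruhatSchwartz K →ₗ[ℂ] BruhatSchwartz K where
  toFun f := ⟨fun x => (ideleNorm g : ℂ) * f.1 (x * (g : Adele K)),
    (BruhatSchwartz K).smul_mem (ideleNorm g : ℂ) (comp_mul_mem g f.2)⟩
  map_add' _ _ := Subtype.ext (funext fun _ => mul_add _ _ _)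
  map_smul' _ _ := Subtype.ext (funext fun _ => mul_left_comm _ _ _)

lemma rhoMap_apply (g : (Adele K)ˣ) (f : BruhatSchwartz K) (x : Adele K) :
    (rhoMap g f).1 x = (ideleNorm g : ℂ) * f.1 (x * (g : Adele K)) := rfl

variable (K) in
/-- The representation `ρ` of `𝔸_K^×` on `𝓢(𝔸_K)`. -/
def rho : Representation ℂ (Adele K)ˣ (BruhatSchwartz K) where
  toFun g := rhoMap g
  map_one' := by
    refine LinearMap.ext fun f => Subtype.ext (funext fun x => ?_)
    rw [rhoMap_apply, map_one, Units.val_one, mul_one, Complex.ofReal_one, one_mul]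
    rfl
  map_mul' g h := by
    refine LinearMap.ext fun f => Subtype.ext (funext fun x => ?_)
    rw [Module.End.mul_apply, rhoMap_apply, rhoMap_apply, rhoMap_apply, map_mul, Units.val_mul,
      Complex.ofReal_mul, mul_assoc, mul_assoc]

variable (K) in
/-- The exterior algebra `Λ𝔸_∞` over the real vector space `𝔸_∞`. -/
abbrev ExtInf : Type _ := ExteriorAlgebra ℝ (InfAdele K)

variable (K) in
/-- The representation `π` of `𝔸_K^×` on `Λ𝔸_∞` induced by the multiplication action of `𝔸_∞^×`
on `𝔸_∞`; finite ideles act trivially. -/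
def piRep : Representation ℝ (Adele K)ˣ (ExtInf K) where
  toFun g := (ExteriorAlgebra.map (LinearMap.mulLeft ℝ (g : Adele K).1)).toLinearMap
  map_one' := by
    simp only [Units.val_one, Prod.fst_one, LinearMap.mulLeft_one, ExteriorAlgebra.map_id]
    rfl
  map_mul' g h := by
    simp only [Units.val_mul, Prod.fst_mul, LinearMap.mulLeft_mul, ← ExteriorAlgebra.map_comp_map]
    rfl

end BruhatSchwartz

/-! ### Tensor products -/

section Tensor

/-- The tensor product over `ℝ` of a complex and a real representation, with the diagonal
action `g ↦ σ_g ⊗ τ_g`. -/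
def tensorRep {G V W : Type*} [Monoid G] [AddCommGroup V] [Module ℂ V] [AddCommGroup W]
    [Module ℝ W] (σ : Representation ℂ G V) (τ : Representation ℝ G W) :
    Representation ℂ G (V ⊗[ℝ] W) where
  toFun g := TensorProduct.AlgebraTensorModule.map (σ g) (τ g)
  map_one' := by
    rw [map_one, map_one]
    exact TensorProduct.AlgebraTensorModule.map_one
  map_mul' g h := by
    rw [map_mul, map_mul]
    exact TensorProduct.AlgebraTensorModule.map_mul _ _ _ _

variable {V W : Type*} [AddCommGroup V] [Module ℝ V] [AddCommGroup W] [Module ℝ W]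

/-- The absolutely convex hull of `{b ⊗ d | b ∈ B, d ∈ D}`. -/
def tensorHull (B : Set V) (D : Set W) : Set (V ⊗[ℝ] W) :=
  absConvexHull ℝ (Set.image2 (fun b d => b ⊗ₜ[ℝ] d) B D)

lemma tensorHull_mono {B B' : Set V} {D D' : Set W} (hB : B ⊆ B') (hD : D ⊆ D') :
    tensorHull B D ⊆ tensorHull B' D' :=
  absConvexHull_mono (Set.image2_subset hB hD)

lemma two_smul_mem_tensorHull {B : Set V} {D : Set W} {t : V ⊗[ℝ] W} (ht : t ∈ tensorHull B D) :
    (2 : ℝ) • t ∈ tensorHull ((fun b => (2 : ℝ) • b) '' B) D := by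
  have key : tensorHull B D ⊆
      (LinearMap.lsmul ℝ (V ⊗[ℝ] W) 2) ⁻¹' tensorHull ((fun b => (2 : ℝ) • b) '' B) D := by
    refine absConvexHull_min ?_ ⟨?_, ?_⟩
    · rintro _ ⟨b, hb, d, hd, rfl⟩
      refine subset_absConvexHull ⟨(2 : ℝ) • b, ⟨b, hb, rfl⟩, d, hd, ?_⟩
      simp [TensorProduct.smul_tmul']
    · intro a ha
      rintro _ ⟨x, hx, rfl⟩
      change (2 : ℝ) • a • x ∈ tensorHull _ D
      rw [smul_comm]
      exact balanced_absConvexHull a ha ⟨(2 : ℝ) • x, hx, rfl⟩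
    · exact convex_absConvexHull.linear_preimage _
  exact key ht

lemma exists_finite_mem_tensorHull (t : V ⊗[ℝ] W) :
    ∃ B : Set V, B.Finite ∧ ∃ D : Set W, D.Finite ∧ t ∈ tensorHull B D := by
  induction t using TensorProduct.induction_on with
  | zero =>
    exact ⟨{0}, Set.finite_singleton _, {0}, Set.finite_singleton _,
      subset_absConvexHull ⟨0, rfl, 0, rfl, by simp⟩⟩
  | tmul x y =>
    exact ⟨{x}, Set.finite_singleton _, {y}, Set.finite_singleton _,
      subset_absConvexHull ⟨x, rfl, y, rfl, rfl⟩⟩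
  | add s t hs ht =>
    obtain ⟨B, hB, D, hD, hs⟩ := hs
    obtain ⟨B', hB', D', hD', ht⟩ := ht
    refine ⟨(fun b => (2 : ℝ) • b) '' (B ∪ B'), (hB.union hB').image _, D ∪ D', hD.union hD', ?_⟩
    have hs' := two_smul_mem_tensorHull
      (tensorHull_mono (Set.subset_union_left (t := B')) (Set.subset_union_left (t := D')) hs)
    have ht' := two_smul_mem_tensorHull
      (tensorHull_mono (Set.subset_union_right (s := B)) (Set.subset_union_right (s := D)) ht)
    have := convex_absConvexHull hs' ht' (a := 1 / 2) (b := 1 / 2) (by norm_num) (by norm_num)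
      (by norm_num)
    simpa [tensorHull, smul_smul] using this

/-- The projective bornology on `V ⊗ W`: a set is bounded if it is contained in the absolutely
convex hull of `B ⊗ D` for bounded subsets `B` of `V` and `D` of `W`. If `V` is complete and `W` is
finite dimensional with its fine bornology, then `V ⊗ W` is already complete. -/
@[reducible] def projectiveBornology (bV : Bornology V) (bW : Bornology W) :
    Bornology (V ⊗[ℝ] W) :=
  Bornology.ofBounded
    {T | ∃ B : Set V, Bornology.IsBounded B ∧ ∃ D : Set W, Bornology.IsBounded D ∧
      T ⊆ tensorHull B D}
    ⟨∅, Bornology.isBounded_empty, ∅, Bornology.isBounded_empty, by simp⟩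
    (by
      rintro T ⟨B, hB, D, hD, h⟩ T' hT
      exact ⟨B, hB, D, hD, hT.trans h⟩)
    (by
      rintro T ⟨B, hB, D, hD, h⟩ T' ⟨B', hB', D', hD', h'⟩
      exact ⟨B ∪ B', hB.union hB', D ∪ D', hD.union hD', Set.union_subset
        (h.trans (tensorHull_mono Set.subset_union_left Set.subset_union_left))
        (h'.trans (tensorHull_mono Set.subset_union_right Set.subset_union_right))⟩)
    (by
      intro t
      obtain ⟨B, hB, D, hD, h⟩ := exists_finite_mem_tensorHull t
      exact ⟨B, hB.isBounded, D, hD.isBounded, by simpa using h⟩)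

variable (W) in
/-- The fine bornology: a set is bounded if it is contained in the absolutely convex hull of a
finite set. On a finite dimensional space this is the usual bornology. -/
@[reducible] def fineBornology : Bornology W :=
  Bornology.ofBounded
    {D | ∃ s : Set W, s.Finite ∧ D ⊆ absConvexHull ℝ s}
    ⟨∅, Set.finite_empty, by simp⟩
    (by
      rintro D ⟨s, hs, h⟩ D' hD
      exact ⟨s, hs, hD.trans h⟩)
    (by
      rintro D ⟨s, hs, h⟩ D' ⟨s', hs', h'⟩
      exact ⟨s ∪ s', hs.union hs', Set.union_subset
        (h.trans (absConvexHull_mono Set.subset_union_left))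
        (h'.trans (absConvexHull_mono Set.subset_union_right))⟩)
    (fun x => ⟨{x}, Set.finite_singleton x, subset_absConvexHull⟩)

end Tensor

/-- The space `𝓢(𝔸_K) ⊗ Λ𝔸_∞`. -/
abbrev SchwartzForms (K : Type*) [Field K] [IsGlobalField K] : Type _ :=
  BruhatSchwartz K ⊗[ℝ] ExtInf K

/-- The bornology on `𝓢(𝔸_K) ⊗ Λ𝔸_∞`. -/
instance schwartzFormsBornology (K : Type*) [Field K] [IsGlobalField K] :
    Bornology (SchwartzForms K) :=
  projectiveBornology (bruhatSchwartzBornology K) (fineBornology (ExtInf K))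

end GlobalAdele

end

/-! The tensor product equals `𝓢(𝔸_K) ⊗_ℂ (ℂ ⊗_ℝ Λ𝔸_∞)`, and the commuting operators `π_g` are
simultaneously diagonalizable on the finite-dimensional space `ℂ ⊗_ℝ Λ𝔸_∞`: the real coordinate
vectors, and two vectors at each complex place with characters `z` and its conjugate, are
eigenvectors, and their products span (`exists_eigenbasis`). So the space splits into copies of
`𝓢(𝔸_K)` on which `g` acts by `χ(g) ρ_g`, where `χ` is a product of coordinates and conjugate
coordinates. It suffices to find, for each `χ`, a topological automorphism of `𝓢(𝔸_∞)` carrying the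
action `f ↦ χ(g) f(x g)` to `f ↦ f(x g)`. Applied on each slice `𝔸_∞ × {y}` it is compatible with
the finite ideles and preserves bounded sets. The admissible `χ` form a monoid (`twists`), which
leaves the case of a single coordinate.

For a real coordinate, multiplication by it and inversion of the partial derivative have the
required equivariance, but neither is bijective on all Schwartz functions. Multiplication maps even
functions onto odd ones, since an odd function vanishes where the coordinate does. The derivative
also maps even functions onto odd ones, because the Fourier transform turns it into multiplication.
Multiplying even functions and integrating odd ones therefore gives an automorphism that exchanges
parities (`exists_real_twist`).

For a complex coordinate `z`, parity is replaced by the weight `n` under rotations. Multiplication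
by `z` is bijective from weight `n` to `n + 1` for `n ≥ 0`, and `∂/∂z` from weight `n + 1` to `n`
for `n < 0`; the twist uses the former and inverts the latter (`exists_complex_twist`). Infinitely
many weights have to be summed. Division by `z` is an average over contractions, with bounds
independent of `n` (`IsScaling.exists_division`), and the part of weight `n` decays like `1 / (1 + n
^ 2)` (`isDominated_weightPart_sq`), so the sum converges. -/

namespace GlobalAdele

open MeasureTheory Filter Topology
open scoped ContDiff FourierTransform RealInnerProductSpace ComplexConjugate

/-! ### Differentiation of parametric integrals. -/

section ParametricIntegral

variable {E F : Type*} [NormedAddCommGroup E] [NormedSpace ℝ E] [NormedAddCommGroup F]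
  [NormedSpace ℝ F]

/-- Differentiation under the integral sign for the iterated derivatives of a parametric
integral over `[0, 1]`. -/
theorem hasFDerivAt_integral_iteratedFDeriv {φ : ℝ → E → F} (hφ : ∀ t, ContDiff ℝ ∞ (φ t))
    (hcont : ∀ m x, Continuous fun t => iteratedFDeriv ℝ m (φ t) x)
    (hbdd : ∀ m, ∃ C, ∀ t ∈ Set.Icc (0 : ℝ) 1, ∀ x, ‖iteratedFDeriv ℝ m (φ t) x‖ ≤ C)
    (m : ℕ) (x : E) :
    HasFDerivAt (fun x => ∫ t in (0 : ℝ)..1, iteratedFDeriv ℝ m (φ t) x)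
      (∫ t in (0 : ℝ)..1, fderiv ℝ (iteratedFDeriv ℝ m (φ t)) x) x := by
  obtain ⟨C, hC⟩ := hbdd (m + 1)
  refine intervalIntegral.hasFDerivAt_integral_of_dominated_of_fderiv_le (bound := fun _ => C)
    (F' := fun x t => fderiv ℝ (iteratedFDeriv ℝ m (φ t)) x)
    Filter.univ_mem (.of_forall fun y => (hcont m y).aestronglyMeasurable)
    ((hcont m x).intervalIntegrable _ _) ?_ ?_ (by simp) ?_
  · have := secondCountableTopologyEither_of_left ℝ (E →L[ℝ] E [×m]→L[ℝ] F)
    refine Continuous.aestronglyMeasurable ?_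
    simp only [fderiv_iteratedFDeriv, Function.comp_apply]
    exact (LinearIsometryEquiv.continuous _).comp (hcont (m + 1) x)
  · refine .of_forall fun t ht y _ => ?_
    rw [Set.uIoc_of_le zero_le_one] at ht
    rw [norm_fderiv_iteratedFDeriv]
    exact hC t ⟨ht.1.le, ht.2⟩ y
  · refine .of_forall fun t _ y _ => ?_
    exact (((hφ t).differentiable_iteratedFDeriv (m := m)
      (by exact_mod_cast ENat.natCast_lt_top m)) y).hasFDerivAt

/-- One derivative at a time moves under the integral; the currying isometries are continuous and
linear, so they commute with it. -/
theorem iteratedFDeriv_integral [CompleteSpace F] {φ : ℝ → E → F}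
    (hφ : ∀ t, ContDiff ℝ ∞ (φ t))
    (hcont : ∀ m x, Continuous fun t => iteratedFDeriv ℝ m (φ t) x)
    (hbdd : ∀ m, ∃ C, ∀ t ∈ Set.Icc (0 : ℝ) 1, ∀ x, ‖iteratedFDeriv ℝ m (φ t) x‖ ≤ C)
    (m : ℕ) :
    iteratedFDeriv ℝ m (fun x => ∫ t in (0 : ℝ)..1, φ t x) =
      fun x => ∫ t in (0 : ℝ)..1, iteratedFDeriv ℝ m (φ t) x := by
  induction m with
  | zero =>
    funext x
    simp only [iteratedFDeriv_zero_eq_comp, Function.comp_apply]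
    refine (ContinuousLinearMap.intervalIntegral_comp_comm
      (((continuousMultilinearCurryFin0 ℝ E F).symm.toContinuousLinearEquiv :
        F ≃L[ℝ] (E [×0]→L[ℝ] F)) : F →L[ℝ] (E [×0]→L[ℝ] F)) ?_).symm
    have h := (continuousMultilinearCurryFin0 ℝ E F).continuous.comp (hcont 0 x)
    simp only [iteratedFDeriv_zero_eq_comp, Function.comp_def,
      LinearIsometryEquiv.apply_symm_apply] at h
    exact h.intervalIntegrable _ _
  | succ m ih =>
    funext x
    rw [iteratedFDeriv_succ_eq_comp_left, Function.comp_apply, ih,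
      (hasFDerivAt_integral_iteratedFDeriv hφ hcont hbdd m x).fderiv]
    simp only [iteratedFDeriv_succ_eq_comp_left, Function.comp_apply]
    refine (ContinuousLinearMap.intervalIntegral_comp_comm (𝕜 := ℝ)
      (E := E →L[ℝ] E [×m]→L[ℝ] F) (F := E [×(m + 1)]→L[ℝ] F)
      (((continuousMultilinearCurryLeftEquiv ℝ (fun _ : Fin (m + 1) => E)
        F).symm.toContinuousLinearEquiv : (E →L[ℝ] E [×m]→L[ℝ] F) ≃L[ℝ] (E [×(m + 1)]→L[ℝ] F)) :
        (E →L[ℝ] E [×m]→L[ℝ] F) →L[ℝ] (E [×(m + 1)]→L[ℝ] F)) ?_).symm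
    refine Continuous.intervalIntegrable ?_ _ _
    simp only [fderiv_iteratedFDeriv, Function.comp_apply]
    exact (LinearIsometryEquiv.continuous _).comp (hcont (m + 1) x)

theorem contDiff_integral [CompleteSpace F] {φ : ℝ → E → F}
    (hφ : ∀ t, ContDiff ℝ ∞ (φ t))
    (hcont : ∀ m x, Continuous fun t => iteratedFDeriv ℝ m (φ t) x)
    (hbdd : ∀ m, ∃ C, ∀ t ∈ Set.Icc (0 : ℝ) 1, ∀ x, ‖iteratedFDeriv ℝ m (φ t) x‖ ≤ C) :
    ContDiff ℝ ∞ fun x => ∫ t in (0 : ℝ)..1, φ t x := by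
  refine contDiff_of_differentiable_iteratedFDeriv fun m _ => ?_
  rw [iteratedFDeriv_integral hφ hcont hbdd]
  exact fun x => (hasFDerivAt_integral_iteratedFDeriv hφ hcont hbdd m x).differentiableAt

end ParametricIntegral

/-! ### Averages of Schwartz functions over families of contractions. -/

section ContractionAverage

variable {E : Type*} [NormedAddCommGroup E] [NormedSpace ℝ E]

theorem iteratedFDeriv_smul_comp (f : 𝓢(E, ℂ)) (c : ℂ) (L : E →L[ℝ] E) (m : ℕ) (x : E) :
    iteratedFDeriv ℝ m (fun x => c * f (L x)) x =
      c • (iteratedFDeriv ℝ m f (L x)).compContinuousLinearMap fun _ => L := by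
  have h : ContDiff ℝ m (f ∘ L) := (f.smooth m).comp L.contDiff
  rw [← L.iteratedFDeriv_comp_right (f.smooth m) x le_rfl]
  exact iteratedFDeriv_const_smul_apply (a := c) (f := f ∘ L) h.contDiffAt

/-- Contractions `L t` and factors `c t` of modulus at most one, for which the functions
`∫ t in 0..1, c t * f (L t x)` are averages. -/
structure IsContractionFamily (c : ℝ → ℂ) (L : ℝ → E →L[ℝ] E) : Prop where
  continuous_weight : Continuous c
  continuous_map : Continuous L
  norm_weight_le : ∀ t ∈ Set.Icc (0 : ℝ) 1, ‖c t‖ ≤ 1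
  norm_map_le : ∀ t ∈ Set.Icc (0 : ℝ) 1, ‖L t‖ ≤ 1

namespace IsContractionFamily

variable {c : ℝ → ℂ} {L : ℝ → E →L[ℝ] E} (f : 𝓢(E, ℂ))

theorem norm_iteratedFDeriv_le (h : IsContractionFamily c L) (m : ℕ) (x : E) {t : ℝ} (ht : t ∈ Set.Icc (0 : ℝ) 1) :
    ‖iteratedFDeriv ℝ m (fun x => c t * f (L t x)) x‖ ≤ ‖iteratedFDeriv ℝ m f (L t x)‖ := by
  rw [iteratedFDeriv_smul_comp, norm_smul]
  calc _ ≤ 1 * (‖iteratedFDeriv ℝ m f (L t x)‖ * ∏ _i : Fin m, ‖L t‖) := by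
        gcongr
        · exact h.norm_weight_le t ht
        · exact ContinuousMultilinearMap.norm_compContinuousLinearMap_le _ _
    _ ≤ 1 * (‖iteratedFDeriv ℝ m f (L t x)‖ * 1) := by
        gcongr
        exact Finset.prod_le_one (fun _ _ => norm_nonneg _) fun _ _ => h.norm_map_le t ht
    _ = _ := by ring

theorem continuous_iteratedFDeriv (h : IsContractionFamily c L) (m : ℕ) (x : E) :
    Continuous fun t => iteratedFDeriv ℝ m (fun x => c t * f (L t x)) x := by
  simp only [iteratedFDeriv_smul_comp]
  refine h.continuous_weight.smul ?_
  have h1 : Continuous fun t => iteratedFDeriv ℝ m f (L t x) :=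
    ((f.smooth m).continuous_iteratedFDeriv le_rfl).comp
      (h.continuous_map.clm_apply continuous_const)
  have h2 : Continuous fun t => ContinuousMultilinearMap.compContinuousLinearMapContinuousMultilinear
      ℝ (fun _ : Fin m => E) (fun _ : Fin m => E) ℂ (fun _ => L t) :=
    (ContinuousMultilinearMap.cont _).comp (continuous_pi fun _ => h.continuous_map)
  exact h2.clm_apply h1

theorem exists_bound (h : IsContractionFamily c L) (m : ℕ) : ∃ C, ∀ t ∈ Set.Icc (0 : ℝ) 1, ∀ x,
    ‖iteratedFDeriv ℝ m (fun x => c t * f (L t x)) x‖ ≤ C :=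
  ⟨SchwartzMap.seminorm ℝ 0 m f, fun _ ht _ => (h.norm_iteratedFDeriv_le f m _ ht).trans
    (f.norm_iteratedFDeriv_le_seminorm ℝ m _)⟩

theorem contDiff_weighted (c : ℝ → ℂ) (L : ℝ → E →L[ℝ] E) (t : ℝ) :
    ContDiff ℝ ∞ fun x => c t * f (L t x) :=
  contDiff_const.mul ((f.smooth ⊤).comp (L t).contDiff)

theorem contDiff_average (h : IsContractionFamily c L) : ContDiff ℝ ∞ fun x => ∫ t in (0 : ℝ)..1, c t * f (L t x) :=
  contDiff_integral (contDiff_weighted f c L) (h.continuous_iteratedFDeriv f) (h.exists_bound f)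

/-- Weights and maps have norm at most one and the interval has length one, so a bound for `f` along
the path `t ↦ L t x` passes to the average with no extra constant. Estimates are thereby uniform
over all families. -/
theorem norm_iteratedFDeriv_average_le (h : IsContractionFamily c L) (m : ℕ) (x : E) {C : ℝ}
    (hC : ∀ t ∈ Set.Icc (0 : ℝ) 1, ‖iteratedFDeriv ℝ m f (L t x)‖ ≤ C) :
    ‖iteratedFDeriv ℝ m (fun x => ∫ t in (0 : ℝ)..1, c t * f (L t x)) x‖ ≤ C := by
  rw [iteratedFDeriv_integral (contDiff_weighted f c L) (h.continuous_iteratedFDeriv f)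
    (h.exists_bound f)]
  refine (intervalIntegral.norm_integral_le_of_norm_le_const (C := C) fun t ht => ?_).trans
    (by simp)
  rw [Set.uIoc_of_le zero_le_one] at ht
  have ht' : t ∈ Set.Icc (0 : ℝ) 1 := ⟨ht.1.le, ht.2⟩
  exact (h.norm_iteratedFDeriv_le f m x ht').trans (hC t ht')

theorem continuous_weighted (h : IsContractionFamily c L) (x : E) : Continuous fun t => c t * f (L t x) :=
  h.continuous_weight.mul (f.continuous.comp (h.continuous_map.clm_apply continuous_const))

theorem average_add (h : IsContractionFamily c L) (g : 𝓢(E, ℂ)) (x : E) :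
    ∫ t in (0 : ℝ)..1, c t * (f + g) (L t x) =
      (∫ t in (0 : ℝ)..1, c t * f (L t x)) + ∫ t in (0 : ℝ)..1, c t * g (L t x) := by
  rw [← intervalIntegral.integral_add ((h.continuous_weighted f x).intervalIntegrable _ _)
    ((h.continuous_weighted g x).intervalIntegrable _ _)]
  simp [mul_add]

theorem average_smul (a : ℂ) (x : E) :
    ∫ t in (0 : ℝ)..1, c t * (a • f) (L t x) = a • ∫ t in (0 : ℝ)..1, c t * f (L t x) := by
  rw [← intervalIntegral.integral_smul]
  simp [mul_left_comm]

end IsContractionFamily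

end ContractionAverage

/-! ### Equicontinuous families of operators on Schwartz space and their sums. -/

section SchwartzOperators

variable {E : Type*} [NormedAddCommGroup E] [NormedSpace ℝ E]

theorem continuous_schwartzSeminorm (k m : ℕ) :
    Continuous (SchwartzMap.seminorm ℂ k m : Seminorm ℂ 𝓢(E, ℂ)) :=
  (schwartz_withSeminorms ℂ E ℂ).continuous_seminorm (k, m)

/-- The sum of the Schwartz seminorms with indices up to `(k, m)`. -/
noncomputable def schwartzNorm (k m : ℕ) : Seminorm ℂ 𝓢(E, ℂ) :=
  ∑ i ∈ Finset.Iic (k, m), schwartzSeminormFamily ℂ E ℂ i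

theorem continuous_schwartzNorm (k m : ℕ) :
    Continuous (schwartzNorm k m : Seminorm ℂ 𝓢(E, ℂ)) := by
  have h : ⇑(schwartzNorm k m : Seminorm ℂ 𝓢(E, ℂ)) =
      fun f => ∑ i ∈ Finset.Iic (k, m), schwartzSeminormFamily ℂ E ℂ i f := by
    ext f
    simp [schwartzNorm, _root_.sum_apply]
  rw [h]
  exact continuous_finsetSum _ fun i _ =>
    (schwartz_withSeminorms ℂ E ℂ).continuous_seminorm i

theorem one_add_pow_mul_le_schwartzNorm {k m i : ℕ} (hi : i ≤ m) (f : 𝓢(E, ℂ)) (x : E) :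
    (1 + ‖x‖) ^ k * ‖iteratedFDeriv ℝ i f x‖ ≤ 2 ^ k * schwartzNorm k m f := by
  refine (SchwartzMap.one_add_le_sup_seminorm_apply (𝕜 := ℂ) (m := (k, m)) le_rfl hi f x).trans ?_
  gcongr
  exact Seminorm.le_def.1 (Seminorm.finset_sup_le_sum _ _) f

/-- An operator that is dominated by continuous seminorms is continuous. -/
theorem exists_clm_of_le_seminorm (A : 𝓢(E, ℂ) → E → ℂ)
    (hadd : ∀ f g x, A (f + g) x = A f x + A g x)
    (hsmul : ∀ (a : ℂ) f x, A (a • f) x = a • A f x)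
    (hsmooth : ∀ f, ContDiff ℝ ∞ (A f))
    (hbound : ∀ k m : ℕ, ∃ q : Seminorm ℂ 𝓢(E, ℂ), Continuous q ∧
      ∀ f x, ‖x‖ ^ k * ‖iteratedFDeriv ℝ m (A f) x‖ ≤ q f) :
    ∃ T : 𝓢(E, ℂ) →L[ℂ] 𝓢(E, ℂ), ∀ f x, T f x = A f x := by
  refine ⟨SchwartzMap.mkCLM A hadd hsmul hsmooth fun n => ?_, fun _ _ => rfl⟩
  obtain ⟨q, hq, h⟩ := hbound n.1 n.2
  obtain ⟨s, C, -, hC⟩ := Seminorm.bound_of_continuous (schwartz_withSeminorms ℂ E ℂ) q hq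
  exact ⟨s, C, C.2, fun f x => (h f x).trans (hC f)⟩

/-- A family of operators `T i` that is equicontinuous up to the factors `u i`. -/
def IsDominated {ι : Type*} (u : ι → ℝ) (T : ι → 𝓢(E, ℂ) →L[ℂ] 𝓢(E, ℂ)) : Prop :=
  ∀ k m, ∃ q : Seminorm ℂ 𝓢(E, ℂ), Continuous q ∧
    ∀ i f, SchwartzMap.seminorm ℂ k m (T i f) ≤ u i * q f

namespace IsDominated

variable {ι : Type*} {u : ι → ℝ} {T T' : ι → 𝓢(E, ℂ) →L[ℂ] 𝓢(E, ℂ)}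

theorem exists_le (h : IsDominated u T) (p : Seminorm ℂ 𝓢(E, ℂ))
    (hp : Continuous p) : ∃ q : Seminorm ℂ 𝓢(E, ℂ), Continuous q ∧
      ∀ i f, p (T i f) ≤ u i * q f := by
  obtain ⟨s, C, -, hC⟩ := Seminorm.bound_of_continuous (schwartz_withSeminorms ℂ E ℂ) p hp
  choose q hq h using h
  refine ⟨C • ∑ i ∈ s, q i.1 i.2, ?_, fun i f => ?_⟩
  · have h : ⇑(C • ∑ i ∈ s, q i.1 i.2) = fun f => C * ∑ i ∈ s, q i.1 i.2 f := by
      ext f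
      simp [_root_.sum_apply, NNReal.smul_def]
    rw [h]
    exact continuous_const.mul (continuous_finsetSum _ fun i _ => hq _ _)
  · refine (hC (T i f)).trans ?_
    have h1 : (s.sup (schwartzSeminormFamily ℂ E ℂ)) (T i f) ≤
        ∑ j ∈ s, schwartzSeminormFamily ℂ E ℂ j (T i f) := by
      rw [← _root_.sum_apply]
      exact Seminorm.le_def.1 (Seminorm.finset_sup_le_sum _ _) _
    have h2 : ∑ j ∈ s, schwartzSeminormFamily ℂ E ℂ j (T i f) ≤ ∑ j ∈ s, u i * q j.1 j.2 f :=
      Finset.sum_le_sum fun j _ => h j.1 j.2 i f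
    simp only [_root_.smul_apply, NNReal.smul_def, _root_.sum_apply, smul_eq_mul]
    rw [mul_left_comm, Finset.mul_sum]
    exact mul_le_mul_of_nonneg_left (h1.trans h2) C.2

theorem comp_left (h : IsDominated u T) (S : 𝓢(E, ℂ) →L[ℂ] 𝓢(E, ℂ)) :
    IsDominated u fun i => S ∘L T i := fun k m => by
  have hc : Continuous ((SchwartzMap.seminorm ℂ k m : Seminorm ℂ 𝓢(E, ℂ)).comp
      (S : 𝓢(E, ℂ) →ₗ[ℂ] 𝓢(E, ℂ))) := (continuous_schwartzSeminorm k m).comp S.continuous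
  obtain ⟨q, hq, h⟩ := h.exists_le _ hc
  exact ⟨q, hq, h⟩

theorem comp_right (h : IsDominated u T) (S : 𝓢(E, ℂ) →L[ℂ] 𝓢(E, ℂ)) :
    IsDominated u fun i => T i ∘L S := fun k m => by
  obtain ⟨q, hq, h⟩ := h k m
  exact ⟨q.comp S.toLinearMap, hq.comp S.continuous, fun i f => h i (S f)⟩

theorem comp_bounded (h : IsDominated u T) (h' : IsDominated 1 T') :
    IsDominated u fun i => T' i ∘L T i := fun k m => by
  obtain ⟨q, hq, h'⟩ := h' k m
  obtain ⟨r, hr, h⟩ := h.exists_le q hq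
  exact ⟨r, hr, fun i f => (h' i (T i f)).trans (by simpa using h i f)⟩

theorem reindex {κ : Type*} (h : IsDominated u T) (e : κ → ι) :
    IsDominated (u ∘ e) fun i => T (e i) := fun k m => by
  obtain ⟨q, hq, h⟩ := h k m
  exact ⟨q, hq, fun i => h (e i)⟩

/-- Splices two families along a case distinction on the index; the complex twist uses different
operators for different signs of the weight. -/
theorem ite {P : ι → Prop} [DecidablePred P] (h : IsDominated u T) (h' : IsDominated u T')
    (hu : ∀ i, 0 ≤ u i) : IsDominated u fun i => if P i then T i else T' i := fun k m => by
  obtain ⟨q, hq, h⟩ := h k m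
  obtain ⟨q', hq', h'⟩ := h' k m
  refine ⟨q + q', hq.add hq', fun i f => ?_⟩
  rw [_root_.add_apply, mul_add]
  dsimp only
  split_ifs
  · exact (h i f).trans (le_add_of_nonneg_right (mul_nonneg (hu i) (apply_nonneg _ _)))
  · exact (h' i f).trans (le_add_of_nonneg_left (mul_nonneg (hu i) (apply_nonneg _ _)))

end IsDominated

section Sum

variable {ι : Type*}

/-- A family of Schwartz functions with summable seminorms is summable. -/
theorem exists_hasSum_of_summable_seminorm {f : ι → 𝓢(E, ℂ)}
    (hf : ∀ k m, Summable fun i => SchwartzMap.seminorm ℂ k m (f i)) :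
    ∃ F : 𝓢(E, ℂ), HasSum f F := by
  have hsm : ∀ i, ContDiff ℝ ((⊤ : ℕ∞) : WithTop ℕ∞) (f i) := fun i => (f i).smooth ⊤
  have hb : ∀ (k : ℕ) (i : ι) (x : E), (k : ℕ∞) ≤ (⊤ : ℕ∞) →
      ‖iteratedFDeriv ℝ k (f i) x‖ ≤ SchwartzMap.seminorm ℂ 0 k (f i) :=
    fun k i x _ => (f i).norm_iteratedFDeriv_le_seminorm ℂ k x
  -- One tail estimate serves twice: for `s = ∅` it is the decay of the sum, and for growing `s` it
  -- is convergence in every seminorm.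
  have hsub : ∀ (s : Finset ι) (k m : ℕ) (x : E),
      ‖x‖ ^ k * ‖∑' i, iteratedFDeriv ℝ m (f i) x - ∑ i ∈ s, iteratedFDeriv ℝ m (f i) x‖ ≤
        ∑' i : {i // i ∉ s}, SchwartzMap.seminorm ℂ k m (f i) := by
    intro s k m x
    have hsum : Summable fun i => iteratedFDeriv ℝ m (f i) x :=
      Summable.of_norm_bounded (hf 0 m) fun i => hb m i x le_top
    rw [← hsum.sum_add_tsum_subtype_compl s, add_sub_cancel_left]
    have h1 : Summable fun i : {i // i ∉ s} => ‖x‖ ^ k * ‖iteratedFDeriv ℝ m (f i) x‖ :=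
      Summable.of_nonneg_of_le (fun _ => by positivity)
        (fun i => (f i).le_seminorm ℂ k m x) ((hf k m).subtype _)
    have h2 : Summable fun i : {i // i ∉ s} => ‖iteratedFDeriv ℝ m (f i) x‖ :=
      Summable.of_nonneg_of_le (fun _ => by positivity)
        (fun i => hb m i x le_top) ((hf 0 m).subtype _)
    calc _ ≤ ‖x‖ ^ k * ∑' i : {i // i ∉ s}, ‖iteratedFDeriv ℝ m (f i) x‖ := by
          gcongr
          exact norm_tsum_le_tsum_norm h2
      _ = ∑' i : {i // i ∉ s}, ‖x‖ ^ k * ‖iteratedFDeriv ℝ m (f i) x‖ := tsum_mul_left.symm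
      _ ≤ _ := h1.tsum_le_tsum (fun i => (f i).le_seminorm ℂ k m x) ((hf k m).subtype _)
  have hiter : ∀ m x, iteratedFDeriv ℝ m (fun y => ∑' i, f i y) x =
      ∑' i, iteratedFDeriv ℝ m (f i) x := fun m x =>
    iteratedFDeriv_tsum_apply hsm (fun k _ => hf 0 k) hb (k := m) le_top x
  let F : 𝓢(E, ℂ) :=
    { toFun := fun y => ∑' i, f i y
      smooth' := contDiff_tsum hsm (fun k _ => hf 0 k) hb
      decay' := fun k m => ⟨_, fun x => by
        have := hsub ∅ k m x
        rw [Finset.sum_empty, sub_zero] at this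
        rw [hiter]
        exact this⟩ }
  refine ⟨F, ?_⟩
  rw [HasSum, (schwartz_withSeminorms ℂ E ℂ).tendsto_nhds]
  rintro ⟨k, m⟩ ε hε
  have h0 := tendsto_tsum_compl_atTop_zero fun i => SchwartzMap.seminorm ℂ k m (f i)
  filter_upwards [h0.eventually (gt_mem_nhds hε)] with s hs
  refine lt_of_le_of_lt ?_ hs
  refine SchwartzMap.seminorm_le_bound ℂ k m _ (tsum_nonneg fun _ => apply_nonneg _ _) fun x => ?_
  have h1 : iteratedFDeriv ℝ m (⇑(∑ i ∈ s, f i - F)) x =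
      ∑ i ∈ s, iteratedFDeriv ℝ m (f i) x - ∑' i, iteratedFDeriv ℝ m (f i) x := by
    rw [← hiter]
    have e : ⇑(∑ i ∈ s, f i - F) = (fun y => ∑ i ∈ s, f i y) - fun y => ∑' i, f i y := by
      ext y
      rw [_root_.sub_apply, _root_.sum_apply]
      rfl
    rw [e, iteratedFDeriv_sub_apply, iteratedFDeriv_fun_sum_apply]
    · exact fun i _ => ((f i).smooth m).contDiffAt
    · exact (ContDiff.sum fun i _ => (f i).smooth m).contDiffAt
    · exact (F.smooth m).contDiffAt
  rw [h1, norm_sub_rev]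
  exact hsub s k m x

/-- A summably dominated family of operators has a sum. -/
theorem IsDominated.exists_hasSum {u : ι → ℝ} {T : ι → 𝓢(E, ℂ) →L[ℂ] 𝓢(E, ℂ)}
    (h : IsDominated u T) (hu : Summable u) :
    ∃ S : 𝓢(E, ℂ) →L[ℂ] 𝓢(E, ℂ), ∀ f, HasSum (fun i => T i f) (S f) := by
  have hs : ∀ f k m, Summable fun i => SchwartzMap.seminorm ℂ k m (T i f) := fun f k m => by
    obtain ⟨q, -, hq⟩ := h k m
    exact Summable.of_nonneg_of_le (fun _ => apply_nonneg _ _) (fun i => hq i f)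
      (hu.mul_right _)
  choose S hS using fun f => exists_hasSum_of_summable_seminorm (hs f)
  let L : 𝓢(E, ℂ) →ₗ[ℂ] 𝓢(E, ℂ) :=
    { toFun := S
      map_add' := fun f g => (hS (f + g)).unique (by simpa using (hS f).add (hS g))
      map_smul' := fun a f => (hS (a • f)).unique (by simpa using (hS f).const_smul a) }
  refine ⟨⟨L, ?_⟩, hS⟩
  refine WithSeminorms.continuous_of_continuous_comp (schwartz_withSeminorms ℂ E ℂ) L ?_
  rintro ⟨k, m⟩
  obtain ⟨q, hq, hT⟩ := h k m
  have hle : ∀ f, SchwartzMap.seminorm ℂ k m (S f) ≤ (∑' i, u i) * q f := fun f => by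
    have h1 := ((continuous_schwartzSeminorm k m).tendsto (S f)).comp (hS f)
    refine le_of_tendsto_of_tendsto h1 (hu.hasSum.mul_right (q f)) (.of_forall fun s => ?_)
    exact (Finset.le_sum_of_subadditive _ (map_zero _).le (map_add_le_add _) _ _).trans (Finset.sum_le_sum fun i _ => hT i f)
  refine Seminorm.continuous_of_le (p := (SchwartzMap.seminorm ℂ k m).comp L)
    -- The sum of `u` is not assumed nonnegative, so its positive part is the factor.
    (q := (Real.toNNReal (∑' i, u i)) • q) ?_ fun f => ?_
  · exact hq.const_smul _
  · refine (hle f).trans ?_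
    simp only [_root_.smul_apply, NNReal.smul_def, smul_eq_mul]
    exact mul_le_mul_of_nonneg_right (Real.le_coe_toNNReal _) (apply_nonneg _ _)

end Sum

end SchwartzOperators

/-! ### Division by a linear form, with uniform seminorm bounds. -/

section Division

universe u

/-- Where `1 ≤ ‖ℓ x‖`, the derivatives of `g` are controlled by those of the product `ℓ • g` with
the linear form `ℓ`. -/
theorem exists_sum_norm_iteratedFDeriv_le {E : Type u} [NormedAddCommGroup E] [NormedSpace ℝ E]
    (ℓ : E →L[ℝ] ℂ) (m : ℕ) : ∃ C : ℝ, 0 ≤ C ∧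
      ∀ (F : Type u) [NormedAddCommGroup F] [NormedSpace ℝ F] [NormedSpace ℂ F]
        [IsScalarTower ℝ ℂ F] [SMulCommClass ℝ ℂ F] (g f : E → F), ContDiff ℝ ∞ g →
        ContDiff ℝ ∞ f → (∀ x, ℓ x • g x = f x) → ∀ x, 1 ≤ ‖ℓ x‖ →
          ∑ i ∈ Finset.range (m + 1), ‖iteratedFDeriv ℝ i g x‖ ≤
            C * ∑ i ∈ Finset.range (m + 1), ‖iteratedFDeriv ℝ i f x‖ := by
  have hzero : ∀ (F : Type u) [NormedAddCommGroup F] [NormedSpace ℂ F] (g f : E → F),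
      (∀ x, ℓ x • g x = f x) → ∀ x, 1 ≤ ‖ℓ x‖ → ‖g x‖ ≤ ‖f x‖ := by
    intro F _ _ g f hgf x hx
    rw [← hgf x, norm_smul]
    exact le_mul_of_one_le_left (norm_nonneg _) hx
  induction m with
  | zero =>
    refine ⟨1, zero_le_one, fun F _ _ _ _ _ g f _ _ hgf x hx => ?_⟩
    simpa using hzero F g f hgf x hx
  | succ m ih =>
    obtain ⟨C, hC, ih⟩ := ih
    -- The product rule gives `ℓ • Dg = Df - Λ g` with `Λ` of norm at most `‖ℓ‖`. The induction
    -- hypothesis is used for `Dg`, which is why the target space varies, and for `g` inside `Λ g`.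
    -- The summand `1` is for order zero.
    refine ⟨1 + C + C * (‖ℓ‖ * C), by positivity, fun F _ _ _ _ _ g f hg hf hgf x hx => ?_⟩
    let B : ℂ →L[ℝ] F →L[ℝ] F := ContinuousLinearMap.lsmul ℝ ℂ
    let Λ : F →L[ℝ] E →L[ℝ] F := (B.comp ℓ).flip
    have hΛ : ‖Λ‖ ≤ ‖ℓ‖ := by
      refine ContinuousLinearMap.opNorm_le_bound _ (norm_nonneg _) fun y => ?_
      refine ContinuousLinearMap.opNorm_le_bound _ (by positivity) fun v => ?_
      change ‖ℓ v • y‖ ≤ _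
      rw [norm_smul, mul_right_comm]
      gcongr
      exact ℓ.le_opNorm v
    have hDg : ContDiff ℝ ∞ (fderiv ℝ g) := hg.fderiv_right (by simp)
    have hDf : ContDiff ℝ ∞ (fderiv ℝ f) := hf.fderiv_right (by simp)
    have hΛg : ContDiff ℝ ∞ fun y => Λ (g y) := Λ.contDiff.comp hg
    have hder : ∀ y, ℓ y • fderiv ℝ g y = fderiv ℝ f y - Λ (g y) := by
      intro y
      have h1 : HasFDerivAt f _ y := ((B.hasFDerivAt_of_bilinear ℓ.hasFDerivAt
        ((hg.differentiable (by simp)) y).hasFDerivAt).congr_of_eventuallyEq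
          (.of_forall fun z => (hgf z).symm))
      rw [h1.fderiv]
      ext v
      simp [B, Λ]
    have h1 := ih (E →L[ℝ] F) (fderiv ℝ g) (fun y => fderiv ℝ f y - Λ (g y)) hDg
      (hDf.sub hΛg) hder x hx
    have h2 := ih F g f hg hf hgf x hx
    have h3 : ∀ i ∈ Finset.range (m + 1),
        ‖iteratedFDeriv ℝ i (fun y => fderiv ℝ f y - Λ (g y)) x‖ ≤
          ‖iteratedFDeriv ℝ (i + 1) f x‖ + ‖ℓ‖ * ‖iteratedFDeriv ℝ i g x‖ := by
      intro i _
      have hi : ((i : ℕ∞) : WithTop ℕ∞) ≤ ∞ := by exact_mod_cast le_top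
      have e : iteratedFDeriv ℝ i (fun y => fderiv ℝ f y - Λ (g y)) x =
          iteratedFDeriv ℝ i (fderiv ℝ f) x - iteratedFDeriv ℝ i (fun y => Λ (g y)) x :=
        iteratedFDeriv_sub_apply (hDf.of_le hi).contDiffAt (hΛg.of_le hi).contDiffAt
      rw [e, ← norm_iteratedFDeriv_fderiv]
      refine (norm_sub_le _ _).trans ?_
      gcongr
      refine (Λ.norm_iteratedFDeriv_comp_left (hg.of_le hi).contDiffAt le_rfl).trans ?_
      gcongr
    have h4 := Finset.sum_le_sum h3
    rw [Finset.sum_add_distrib, ← Finset.mul_sum] at h4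
    rw [Finset.sum_range_succ', Finset.sum_range_succ' (fun i => ‖iteratedFDeriv ℝ i f x‖)]
    simp only [norm_iteratedFDeriv_zero, norm_iteratedFDeriv_fderiv] at h1 ⊢
    have h0 := hzero F g f hgf x hx
    set S := ∑ i ∈ Finset.range (m + 1), ‖iteratedFDeriv ℝ (i + 1) f x‖ with hS
    have hS0 : 0 ≤ S := Finset.sum_nonneg fun _ _ => norm_nonneg _
    have h5 : ∑ i ∈ Finset.range (m + 1), ‖iteratedFDeriv ℝ i f x‖ ≤ S + ‖f x‖ := by
      rw [Finset.sum_range_succ', norm_iteratedFDeriv_zero]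
      gcongr
      rw [hS, Finset.sum_range_succ]
      exact le_add_of_nonneg_right (norm_nonneg _)
    calc _ ≤ C * (S + ‖ℓ‖ * (C * (S + ‖f x‖))) + ‖f x‖ := by
          gcongr
          refine h1.trans (mul_le_mul_of_nonneg_left (h4.trans ?_) hC)
          gcongr
          exact h2.trans (mul_le_mul_of_nonneg_left h5 hC)
      _ ≤ _ := by
          have : 0 ≤ C * ‖f x‖ := by positivity
          nlinarith [norm_nonneg (f x)]

theorem exists_norm_iteratedFDeriv_le {E : Type*} [NormedAddCommGroup E] [NormedSpace ℝ E]
    (ℓ : E →L[ℝ] ℂ) (m : ℕ) : ∃ C : ℝ, 0 ≤ C ∧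
      ∀ (g f : E → ℂ), ContDiff ℝ ∞ g → ContDiff ℝ ∞ f → (∀ x, ℓ x * g x = f x) →
        ∀ x, 1 ≤ ‖ℓ x‖ → ‖iteratedFDeriv ℝ m g x‖ ≤
            C * ∑ i ∈ Finset.range (m + 1), ‖iteratedFDeriv ℝ i f x‖ := by
  obtain ⟨C, hC, h⟩ := exists_sum_norm_iteratedFDeriv_le ℓ m
  refine ⟨C, hC, fun g f hg hf hgf x hx => ?_⟩
  -- Moves the target `ℂ` isometrically into the universe of `E`, as the induction required.
  let e : ℂ ≃ₗᵢ[ℝ] (E [×0]→L[ℝ] ℂ) := (continuousMultilinearCurryFin0 ℝ E ℂ).symm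
  have h1 := h (E [×0]→L[ℝ] ℂ) (e ∘ g) (e ∘ f) (e.contDiff.comp hg) (e.contDiff.comp hf)
    (fun y => by
      ext v
      simpa [e] using hgf y) x hx
  simp only [LinearIsometryEquiv.norm_iteratedFDeriv_comp_left] at h1
  exact (Finset.single_le_sum (f := fun i => ‖iteratedFDeriv ℝ i g x‖)
    (fun _ _ => norm_nonneg _) (Finset.self_mem_range_succ m)).trans h1

variable {E : Type*} [NormedAddCommGroup E] [NormedSpace ℝ E]

/-- A linear form `ℓ` and an operator `q` bounded by it such that the scalings
`1 - (1 - t) q` for `0 ≤ t ≤ 1` are contractions. -/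
structure IsScaling (ℓ : E →L[ℝ] ℂ) (q : E →L[ℝ] E) : Prop where
  norm_apply_le : ∀ x, ‖q x‖ ≤ ‖ℓ x‖
  norm_le : ∀ t ∈ Set.Icc (0 : ℝ) 1, ‖ContinuousLinearMap.id ℝ E - (1 - t) • q‖ ≤ 1

namespace IsScaling

variable {ℓ : E →L[ℝ] ℂ} {q : E →L[ℝ] E}

theorem isContractionFamily (h : IsScaling ℓ q) (n : ℕ) :
    IsContractionFamily (fun t => (t : ℂ) ^ n)
      fun t => ContinuousLinearMap.id ℝ E - (1 - t) • q where
  continuous_weight := by fun_prop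
  continuous_map := by fun_prop
  norm_weight_le t ht := by
    rw [norm_pow, Complex.norm_of_nonneg ht.1]
    exact pow_le_one₀ ht.1 ht.2
  norm_map_le := h.norm_le

/-- Where `1 ≤ ‖ℓ x‖` the average is a genuine quotient, controlled by `g`. Where `‖ℓ x‖ ≤ 1` the
contractions move `x` by at most one, so the decay of `f` survives averaging. The constant depends
on neither `n` nor the functions. -/
theorem exists_average_bound (h : IsScaling ℓ q) (k m : ℕ) : ∃ C : ℝ, 0 ≤ C ∧
    ∀ (n : ℕ) (f g : 𝓢(E, ℂ)),
      (∀ x, ℓ x * ∫ t in (0 : ℝ)..1, (t : ℂ) ^ n *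
        f ((ContinuousLinearMap.id ℝ E - (1 - t) • q) x) = g x) →
      ∀ x, ‖x‖ ^ k * ‖iteratedFDeriv ℝ m (fun x => ∫ t in (0 : ℝ)..1, (t : ℂ) ^ n *
        f ((ContinuousLinearMap.id ℝ E - (1 - t) • q) x)) x‖ ≤
          C * (schwartzNorm k m f + schwartzNorm k m g) := by
  obtain ⟨C, hC, hdiv⟩ := exists_norm_iteratedFDeriv_le ℓ m
  refine ⟨4 ^ k + C * ((m + 1) * 2 ^ k), by positivity, fun n f g hfg x => ?_⟩
  have hf0 : 0 ≤ schwartzNorm k m f := apply_nonneg _ _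
  have hg0 : 0 ≤ schwartzNorm k m g := apply_nonneg _ _
  have hx1 : ‖x‖ ^ k ≤ (1 + ‖x‖) ^ k := by
    gcongr
    linarith
  rcases le_total 1 ‖ℓ x‖ with hx | hx
  · have h1 := hdiv _ g ((h.isContractionFamily n).contDiff_average f) (g.smooth ⊤) hfg x hx
    calc _ ≤ ‖x‖ ^ k * (C * ∑ i ∈ Finset.range (m + 1), ‖iteratedFDeriv ℝ i g x‖) := by
          gcongr
      _ = C * ∑ i ∈ Finset.range (m + 1), ‖x‖ ^ k * ‖iteratedFDeriv ℝ i g x‖ := by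
          rw [← Finset.mul_sum]
          ring
      _ ≤ C * ∑ i ∈ Finset.range (m + 1), 2 ^ k * schwartzNorm k m g := by
          refine mul_le_mul_of_nonneg_left (Finset.sum_le_sum fun i hi => ?_) hC
          refine le_trans ?_ (one_add_pow_mul_le_schwartzNorm
            (Nat.lt_succ_iff.1 (Finset.mem_range.1 hi)) g x)
          gcongr
      _ = C * ((m + 1) * 2 ^ k) * schwartzNorm k m g := by
          rw [Finset.sum_const, Finset.card_range, nsmul_eq_mul]
          push_cast
          ring
      _ ≤ _ := by
          have : 0 ≤ C * ((m + 1) * 2 ^ k) := by positivity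
          have : (0 : ℝ) ≤ 4 ^ k := by positivity
          nlinarith [mul_nonneg this hf0, mul_nonneg this hg0,
            mul_nonneg ‹0 ≤ C * ((m + 1) * 2 ^ k)› hf0]
  · have h1 := (h.isContractionFamily n).norm_iteratedFDeriv_average_le f m x
      -- One factor `2 ^ k` compares `1 + ‖x‖` with `1 + ‖y‖` for the contracted point `y`; the
      -- other comes from `one_add_pow_mul_le_schwartzNorm`.
      (C := 4 ^ k * schwartzNorm k m f / (1 + ‖x‖) ^ k) fun t ht => by
        set y := (ContinuousLinearMap.id ℝ E - (1 - t) • q) x with hy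
        have hxy : ‖x‖ ≤ ‖y‖ + 1 := by
          have e : x = y + (1 - t) • q x := by
            rw [hy]
            simp
          calc ‖x‖ = ‖y + (1 - t) • q x‖ := by rw [← e]
            _ ≤ ‖y‖ + ‖(1 - t) • q x‖ := norm_add_le _ _
            _ ≤ ‖y‖ + 1 := by
              gcongr
              rw [norm_smul, Real.norm_of_nonneg (sub_nonneg.2 ht.2)]
              exact mul_le_one₀ (by linarith [ht.1]) (norm_nonneg _)
                ((h.norm_apply_le x).trans hx)
        have h2 : (1 + ‖x‖) ^ k ≤ 2 ^ k * (1 + ‖y‖) ^ k := by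
          rw [← mul_pow]
          gcongr
          linarith [norm_nonneg y]
        rw [le_div_iff₀ (by positivity)]
        calc _ ≤ ‖iteratedFDeriv ℝ m f y‖ * (2 ^ k * (1 + ‖y‖) ^ k) := by gcongr
          _ = 2 ^ k * ((1 + ‖y‖) ^ k * ‖iteratedFDeriv ℝ m f y‖) := by ring
          _ ≤ 2 ^ k * (2 ^ k * schwartzNorm k m f) := by
            exact mul_le_mul_of_nonneg_left (one_add_pow_mul_le_schwartzNorm le_rfl f y)
              (by positivity)
          _ = _ := by
            rw [← mul_assoc, ← mul_pow]
            norm_num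
    rw [le_div_iff₀ (by positivity)] at h1
    calc _ ≤ (1 + ‖x‖) ^ k * _ := by gcongr
      _ ≤ 4 ^ k * schwartzNorm k m f := by
        rw [mul_comm]
        exact h1
      _ ≤ _ := by
          have h3 : 0 ≤ C * ((m + 1) * 2 ^ k) := by positivity
          have h4 : (0 : ℝ) ≤ 4 ^ k := by positivity
          nlinarith [mul_nonneg h3 hf0, mul_nonneg h3 hg0, mul_nonneg h4 hg0]

/-- If the averages of `H i f` over the scalings are quotients of `G i f` by `ℓ`, then division
of `G i f` by `ℓ` is a continuous operator, with bounds that are inherited from `H` and `G`. -/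
theorem exists_division (h : IsScaling ℓ q) {ι : Type*} {u : ι → ℝ} (n : ι → ℕ)
    {H G : ι → 𝓢(E, ℂ) →L[ℂ] 𝓢(E, ℂ)} (hH : IsDominated u H) (hG : IsDominated u G)
    (hHG : ∀ i f x, ℓ x * ∫ t in (0 : ℝ)..1, (t : ℂ) ^ n i *
      H i f ((ContinuousLinearMap.id ℝ E - (1 - t) • q) x) = G i f x) :
    ∃ N : ι → 𝓢(E, ℂ) →L[ℂ] 𝓢(E, ℂ), IsDominated u N ∧ ∀ i f x, ℓ x * N i f x = G i f x := by
  choose C hC hbound using h.exists_average_bound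
  have hN : ∀ i, ∃ N : 𝓢(E, ℂ) →L[ℂ] 𝓢(E, ℂ), ∀ f x, N f x =
      ∫ t in (0 : ℝ)..1, (t : ℂ) ^ n i *
        H i f ((ContinuousLinearMap.id ℝ E - (1 - t) • q) x) := by
    intro i
    refine exists_clm_of_le_seminorm _ (fun f g x => ?_) (fun a f x => ?_)
      (fun f => (h.isContractionFamily (n i)).contDiff_average (H i f)) fun k m => ?_
    · rw [map_add]
      exact (h.isContractionFamily (n i)).average_add _ _ _
    · rw [map_smul]
      exact IsContractionFamily.average_smul _ _ _
    · let r : Seminorm ℂ 𝓢(E, ℂ) := (schwartzNorm k m).comp (H i : 𝓢(E, ℂ) →ₗ[ℂ] 𝓢(E, ℂ)) +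
        (schwartzNorm k m).comp (G i : 𝓢(E, ℂ) →ₗ[ℂ] 𝓢(E, ℂ))
      have hr : Continuous r := ((continuous_schwartzNorm k m).comp (H i).continuous).add
        ((continuous_schwartzNorm k m).comp (G i).continuous)
      let c : ℝ≥0 := ⟨C k m, hC k m⟩
      refine ⟨c • r, hr.const_smul _, fun f x => ?_⟩
      exact hbound k m (n i) (H i f) (G i f) (hHG i f) x
  choose N hN using hN
  refine ⟨N, fun k m => ?_, fun i f x => by rw [hN, hHG]⟩
  obtain ⟨r, hr, hHr⟩ := hH.exists_le _ (continuous_schwartzNorm k m)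
  obtain ⟨s, hs, hGs⟩ := hG.exists_le _ (continuous_schwartzNorm k m)
  let c : ℝ≥0 := ⟨C k m, hC k m⟩
  refine ⟨c • (r + s), (hr.add hs).const_smul c, fun i f => ?_⟩
  have h1 : SchwartzMap.seminorm ℂ k m (N i f) ≤
      C k m * (schwartzNorm k m (H i f) + schwartzNorm k m (G i f)) := by
    refine SchwartzMap.seminorm_le_bound ℂ k m _
      (mul_nonneg (hC k m) (add_nonneg (apply_nonneg _ _) (apply_nonneg _ _))) fun x => ?_
    rw [funext (hN i f)]
    exact hbound k m (n i) (H i f) (G i f) (hHG i f) x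
  refine h1.trans ((mul_le_mul_of_nonneg_left (add_le_add (hHr i f) (hGs i f))
    (hC k m)).trans_eq ?_)
  change _ = u i * (C k m * (r f + s f))
  ring

end IsScaling

end Division

/-! ### Multiplication, pullback and directional derivatives. -/

section BasicOperators

variable {E : Type*} [NormedAddCommGroup E] [NormedSpace ℝ E]

/-- Multiplication of Schwartz functions by a linear form. -/
noncomputable def mulForm (ℓ : E →L[ℝ] ℂ) : 𝓢(E, ℂ) →L[ℂ] 𝓢(E, ℂ) := SchwartzMap.smulLeftCLM ℂ ℓ

theorem mulForm_apply (ℓ : E →L[ℝ] ℂ) (f : 𝓢(E, ℂ)) (x : E) : mulForm ℓ f x = ℓ x * f x :=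
  SchwartzMap.smulLeftCLM_apply_apply ℓ.hasTemperateGrowth f x

/-- Off the kernel of `ℓ` one can divide; a point of the kernel is a limit of points `x + t • v`
with `ℓ v ≠ 0`, and `f` is continuous. -/
theorem mulForm_injective {ℓ : E →L[ℝ] ℂ} (hℓ : ℓ ≠ 0) : Function.Injective (mulForm ℓ) := by
  refine (injective_iff_map_eq_zero _).2 fun f hf => SchwartzMap.ext fun x => ?_
  have hx : ∀ y, ℓ y ≠ 0 → f y = 0 := fun y hy => by
    have := congrArg (fun g : 𝓢(E, ℂ) => g y) hf
    simpa [mulForm_apply, hy] using this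
  by_cases h : ℓ x = 0
  · obtain ⟨v, hv⟩ : ∃ v, ℓ v ≠ 0 := by
      by_contra! h0
      exact hℓ (ContinuousLinearMap.ext h0)
    have hc : Continuous fun t : ℝ => f (x + t • v) := by fun_prop
    have h1 : Tendsto (fun t : ℝ => f (x + t • v)) (𝓝[≠] 0) (𝓝 (f x)) := by
      have := hc.tendsto 0
      simp only [zero_smul, add_zero] at this
      exact this.mono_left nhdsWithin_le_nhds
    have h2 : Tendsto (fun t : ℝ => f (x + t • v)) (𝓝[≠] 0) (𝓝 0) := by
      refine tendsto_const_nhds.congr' ?_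
      filter_upwards [self_mem_nhdsWithin] with t ht
      refine (hx _ ?_).symm
      simpa [h, hv] using ht
    exact tendsto_nhds_unique h1 h2
  · exact hx x h

/-- Composition of Schwartz functions with a linear automorphism. -/
noncomputable def pullback (L : E ≃L[ℝ] E) : 𝓢(E, ℂ) →L[ℂ] 𝓢(E, ℂ) :=
  SchwartzMap.compCLMOfContinuousLinearEquiv ℂ L

theorem pullback_apply (L : E ≃L[ℝ] E) (f : 𝓢(E, ℂ)) (x : E) : pullback L f x = f (L x) := rfl

theorem pullback_mulForm {ℓ : E →L[ℝ] ℂ} {L : E ≃L[ℝ] E} {a : ℂ} (h : ∀ x, ℓ (L x) = a * ℓ x)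
    (f : 𝓢(E, ℂ)) : pullback L (mulForm ℓ f) = a • mulForm ℓ (pullback L f) := by
  ext x
  simp only [pullback_apply, mulForm_apply, _root_.smul_apply, smul_eq_mul, h]
  ring

/-- The derivative of Schwartz functions in the direction `v`. -/
noncomputable def dirDeriv (v : E) : 𝓢(E, ℂ) →L[ℂ] 𝓢(E, ℂ) :=
  LineDeriv.lineDerivOpCLM ℂ 𝓢(E, ℂ) v

theorem dirDeriv_apply (v : E) (f : 𝓢(E, ℂ)) (x : E) : dirDeriv v f x = fderiv ℝ f x v :=
  SchwartzMap.lineDerivOp_apply_eq_fderiv v f x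

theorem dirDeriv_pullback (v : E) (L : E ≃L[ℝ] E) (f : 𝓢(E, ℂ)) (x : E) :
    dirDeriv v (pullback L f) x = fderiv ℝ f (L x) (L v) := by
  have h : HasFDerivAt (pullback L f) ((fderiv ℝ f (L x)).comp (L : E →L[ℝ] E)) x :=
    (f.hasFDerivAt (L x)).comp x L.hasFDerivAt
  rw [dirDeriv_apply, h.fderiv]
  rfl

end BasicOperators

/-! ### The Fourier transform and operators conjugate to multiplication. -/

section Fourier

variable {E : Type*} [NormedAddCommGroup E] [InnerProductSpace ℝ E] [FiniteDimensional ℝ E]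
  [MeasurableSpace E] [BorelSpace E]

variable (E) in
/-- The Fourier transform on Schwartz functions. -/
noncomputable def fourierEquiv : 𝓢(E, ℂ) ≃L[ℂ] 𝓢(E, ℂ) := FourierTransform.fourierCLE ℂ 𝓢(E, ℂ)

/-- For a general automorphism the inverse transpose would appear on the right. The Fourier
transform therefore serves only to invert derivatives and to track parity and weights; equivariance
of antiderivatives is checked after differentiating. -/
theorem fourierEquiv_pullback (A : E ≃ₗᵢ[ℝ] E) (f : 𝓢(E, ℂ)) :
    fourierEquiv E (pullback A.toContinuousLinearEquiv f) =
      pullback A.toContinuousLinearEquiv (fourierEquiv E f) := by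
  ext x
  exact Real.fourier_comp_linearIsometry A f x

theorem fourierEquiv_dirDeriv (v : E) (f : 𝓢(E, ℂ)) (x : E) :
    fourierEquiv E (dirDeriv v f) x =
      2 * Real.pi * Complex.I * (⟪v, x⟫ : ℝ) * fourierEquiv E f x := by
  have h := congrArg (fun g : 𝓢(E, ℂ) => g x) (SchwartzMap.fourier_lineDerivOp_eq f v)
  have hv : (inner ℝ · v : E → ℝ).HasTemperateGrowth := ((innerSL ℝ).flip v).hasTemperateGrowth
  simp only [_root_.smul_apply, SchwartzMap.smulLeftCLM_apply_apply hv] at h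
  refine h.trans ?_
  rw [real_inner_comm, smul_eq_mul, Complex.real_smul, ← mul_assoc]
  rfl

/-- An operator `D` that the Fourier transform turns into multiplication by a linear form. -/
def IsFourierMul (D : 𝓢(E, ℂ) →L[ℂ] 𝓢(E, ℂ)) (μ : E →L[ℝ] ℂ) (c : ℂ) : Prop :=
  ∀ f, fourierEquiv E (D f) = c • mulForm μ (fourierEquiv E f)

theorem IsFourierMul.injective {D : 𝓢(E, ℂ) →L[ℂ] 𝓢(E, ℂ)} {μ : E →L[ℝ] ℂ} {c : ℂ}
    (h : IsFourierMul D μ c) (hμ : μ ≠ 0) (hc : c ≠ 0) : Function.Injective D := by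
  intro f g hfg
  have h1 := congrArg (fourierEquiv E) hfg
  rw [h, h] at h1
  exact (fourierEquiv E).injective (mulForm_injective hμ (smul_right_injective _ hc h1))

/-- The operator that corresponds to `c⁻¹ • N` under the Fourier transform. -/
noncomputable def fourierConj (c : ℂ) (N : 𝓢(E, ℂ) →L[ℂ] 𝓢(E, ℂ)) : 𝓢(E, ℂ) →L[ℂ] 𝓢(E, ℂ) :=
  c⁻¹ • ((fourierEquiv E).symm : 𝓢(E, ℂ) →L[ℂ] 𝓢(E, ℂ)) ∘L N ∘L
    (fourierEquiv E : 𝓢(E, ℂ) →L[ℂ] 𝓢(E, ℂ))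

/-- Solving `D u = g` amounts to dividing the Fourier transform of `g` by `μ`. -/
theorem IsFourierMul.apply_fourierConj {D : 𝓢(E, ℂ) →L[ℂ] 𝓢(E, ℂ)} {μ : E →L[ℝ] ℂ} {c : ℂ}
    (h : IsFourierMul D μ c) (hc : c ≠ 0) {N : 𝓢(E, ℂ) →L[ℂ] 𝓢(E, ℂ)} {f g : 𝓢(E, ℂ)}
    (hN : mulForm μ (N (fourierEquiv E f)) = fourierEquiv E g) : D (fourierConj c N f) = g := by
  apply (fourierEquiv E).injective
  rw [h]
  simp only [fourierConj, _root_.smul_apply, ContinuousLinearMap.comp_apply, map_smul,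
    ContinuousLinearEquiv.coe_coe, ContinuousLinearEquiv.apply_symm_apply, hN,
    smul_inv_smul₀ hc]

end Fourier

/-! ### Orthogonal coordinates and operators acting on one coordinate. -/

section Coordinate

variable {E F : Type*} [NormedAddCommGroup E] [InnerProductSpace ℝ E] [CompleteSpace E]
  [NormedAddCommGroup F] [InnerProductSpace ℝ F] [CompleteSpace F] (j : F →ₗᵢ[ℝ] E)

/-- The orthogonal projection of `E` to the isometrically embedded space `F`. -/
noncomputable def coord : E →L[ℝ] F := ContinuousLinearMap.adjoint j.toContinuousLinearMap

theorem inner_coord (c : F) (x : E) : ⟪c, coord j x⟫ = ⟪j c, x⟫ :=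
  ContinuousLinearMap.adjoint_inner_right j.toContinuousLinearMap c x

theorem coord_self (c : F) : coord j (j c) = c :=
  ext_inner_left ℝ fun d => by rw [inner_coord, j.inner_map_map]

/-- The operator that acts by `A` on the image of `j` and trivially on its complement. -/
noncomputable def act (A : F →L[ℝ] F) : E →L[ℝ] E :=
  ContinuousLinearMap.id ℝ E +
    j.toContinuousLinearMap ∘L (A - ContinuousLinearMap.id ℝ F) ∘L coord j

variable {j}

theorem act_apply (A : F →L[ℝ] F) (x : E) :
    act j A x = x + j (A (coord j x) - coord j x) := rfl

theorem coord_act (A : F →L[ℝ] F) (x : E) : coord j (act j A x) = A (coord j x) := by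
  rw [act_apply, map_add, coord_self, add_sub_cancel]

theorem act_self (A : F →L[ℝ] F) (c : F) : act j A (j c) = j (A c) := by
  rw [act_apply, coord_self, map_sub, add_sub_cancel]

theorem act_act (A B : F →L[ℝ] F) (x : E) : act j A (act j B x) = act j (A ∘L B) x := by
  rw [act_apply, coord_act, act_apply, act_apply, add_assoc, ← map_add]
  congr 2
  simp

theorem act_id (x : E) : act j (ContinuousLinearMap.id ℝ F) x = x := by
  simp [act_apply]

theorem norm_act_sq (A : F →L[ℝ] F) (x : E) :
    ‖act j A x‖ ^ 2 = ‖x - j (coord j x)‖ ^ 2 + ‖A (coord j x)‖ ^ 2 := by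
  have h : act j A x = (x - j (coord j x)) + j (A (coord j x)) := by
    rw [act_apply, map_sub]
    abel
  have h0 : ⟪x - j (coord j x), j (A (coord j x))⟫ = 0 := by
    rw [real_inner_comm, ← inner_coord, map_sub, coord_self, sub_self, inner_zero_right]
  rw [h, norm_add_sq_real, h0, j.norm_map]
  ring

theorem norm_sq_eq (x : E) : ‖x‖ ^ 2 = ‖x - j (coord j x)‖ ^ 2 + ‖coord j x‖ ^ 2 := by
  have := norm_act_sq (j := j) (ContinuousLinearMap.id ℝ F) x
  rwa [act_id] at this

theorem norm_act_le {A : F →L[ℝ] F} (hA : ∀ c, ‖A c‖ ≤ ‖c‖) (x : E) : ‖act j A x‖ ≤ ‖x‖ := by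
  refine le_of_sq_le_sq ?_ (norm_nonneg _)
  rw [norm_act_sq, norm_sq_eq (j := j) x]
  gcongr
  exact hA _

/-- The operator `1 - (1 - t) q` multiplies the coordinate by `t` and fixes its orthogonal
complement, hence is a contraction. -/
theorem isScaling_coord {ℓ : E →L[ℝ] ℂ} (hℓ : ∀ x, ‖ℓ x‖ = ‖coord j x‖) :
    IsScaling ℓ (j.toContinuousLinearMap ∘L coord j) where
  norm_apply_le x := by
    rw [hℓ]
    exact (j.norm_map _).le
  norm_le t ht := by
    have h : ContinuousLinearMap.id ℝ E - (1 - t) • (j.toContinuousLinearMap ∘L coord j) =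
        act j (t • ContinuousLinearMap.id ℝ F) := by
      ext x
      simp only [act_apply, _root_.sub_apply, _root_.smul_apply, ContinuousLinearMap.id_apply,
        ContinuousLinearMap.comp_apply, map_sub, map_smul, sub_smul, one_smul]
      change x - (j (coord j x) - t • j (coord j x)) = _
      abel
    rw [h]
    refine ContinuousLinearMap.opNorm_le_bound _ zero_le_one fun x => ?_
    rw [one_mul]
    refine norm_act_le (fun c => ?_) x
    rw [_root_.smul_apply, norm_smul, Real.norm_of_nonneg ht.1]
    exact mul_le_of_le_one_left (norm_nonneg _) ht.2

variable (j) in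
/-- The isometry that acts by `A` on the image of `j` and trivially on its complement. -/
noncomputable def actIsometry (A : F ≃ₗᵢ[ℝ] F) : E ≃ₗᵢ[ℝ] E where
  toFun := act j A.toContinuousLinearEquiv
  invFun := act j A.symm.toContinuousLinearEquiv
  map_add' := map_add _
  map_smul' := map_smul _
  left_inv x := by
    rw [act_act]
    convert! act_id (j := j) x
    ext
    simp
  right_inv x := by
    rw [act_act]
    convert! act_id (j := j) x
    ext
    simp
  norm_map' x := by
    change ‖act j A.toContinuousLinearEquiv x‖ = ‖x‖
    rw [← sq_eq_sq₀ (norm_nonneg _) (norm_nonneg _), norm_act_sq, norm_sq_eq (j := j) x]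
    congr 2
    exact A.norm_map _

theorem actIsometry_apply (A : F ≃ₗᵢ[ℝ] F) (x : E) :
    actIsometry j A x = x + j (A (coord j x) - coord j x) := rfl

/-- If `L` acts by `B` on the coordinate, then it commutes with the isometries that are given by
isometries of the coordinate commuting with `B`. -/
theorem actIsometry_comm {L : E ≃L[ℝ] E} {B : F →L[ℝ] F} (hL : ∀ c, L (j c) = j (B c))
    (hL' : ∀ x, coord j (L x) = B (coord j x)) {A : F ≃ₗᵢ[ℝ] F} (hA : ∀ c, A (B c) = B (A c))
    (x : E) : actIsometry j A (L x) = L (actIsometry j A x) := by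
  simp only [actIsometry_apply, map_add, hL, hL', hA, map_sub]

end Coordinate

theorem isDominated_const {E ι : Type*} [NormedAddCommGroup E] [NormedSpace ℝ E]
    (T : 𝓢(E, ℂ) →L[ℂ] 𝓢(E, ℂ)) : IsDominated (fun _ : ι => 1) fun _ => T := fun k m => by
  have hc : Continuous ((SchwartzMap.seminorm ℂ k m : Seminorm ℂ 𝓢(E, ℂ)).comp
      (T : 𝓢(E, ℂ) →ₗ[ℂ] 𝓢(E, ℂ))) := (continuous_schwartzSeminorm k m).comp T.continuous
  exact ⟨_, hc, fun _ f => (one_mul _).ge⟩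

theorem dirDeriv_pullback_real {E : Type*} [NormedAddCommGroup E] [InnerProductSpace ℝ E]
    (j : ℝ →ₗᵢ[ℝ] E) {L : E ≃L[ℝ] E} {a : ℝ}
    (hL : ∀ c, L (j c) = j (a * c)) (f : 𝓢(E, ℂ)) :
    dirDeriv (j 1) (pullback L f) = (a : ℂ) • pullback L (dirDeriv (j 1) f) := by
  ext x
  rw [dirDeriv_pullback, hL, mul_comm a, ← smul_eq_mul 1 a, smul_eq_mul, one_mul,
    ← mul_one a, ← smul_eq_mul a 1, map_smul, map_smul, _root_.smul_apply, pullback_apply,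
    dirDeriv_apply]
  simp

/-! ### The twist by a real coordinate: even and odd functions. -/

section RealCoordinate

variable {E : Type*} [NormedAddCommGroup E] [InnerProductSpace ℝ E] [FiniteDimensional ℝ E]
  (j : ℝ →ₗᵢ[ℝ] E)

/-- A real coordinate as a complex valued linear form. -/
noncomputable def realForm : E →L[ℝ] ℂ := Complex.ofRealCLM ∘L coord j

theorem realForm_apply (x : E) : realForm j x = (coord j x : ℂ) := rfl

theorem realForm_ne_zero : realForm j ≠ 0 := fun h => by
  have := congrArg (fun ℓ : E →L[ℝ] ℂ => ℓ (j 1)) h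
  simp [realForm_apply, coord_self] at this

theorem realForm_semiconj {L : E ≃L[ℝ] E} {a : ℝ} (hL : ∀ x, coord j (L x) = a * coord j x)
    (x : E) : realForm j (L x) = a * realForm j x := by
  simp [realForm_apply, hL]

/-- The reflection that changes the sign of a real coordinate. -/
noncomputable def reflect : E ≃ₗᵢ[ℝ] E := actIsometry j (LinearIsometryEquiv.neg ℝ)

theorem reflect_self (c : ℝ) : reflect j (j c) = j (-1 * c) :=
  (act_self _ c).trans (by simp)

theorem coord_reflect (x : E) : coord j (reflect j x) = -1 * coord j x :=
  (coord_act _ x).trans (by simp)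

theorem reflect_reflect (x : E) : reflect j (reflect j x) = x := by
  have h := (reflect j).symm_apply_apply x
  rwa [show (reflect j).symm (reflect j x) = reflect j (reflect j x) from rfl] at h

theorem reflect_of_coord_eq_zero {x : E} (hx : coord j x = 0) : reflect j x = x := by
  simp [reflect, actIsometry_apply, hx]

/-- Composition with the reflection in a real coordinate. -/
noncomputable def reflectOp : 𝓢(E, ℂ) →L[ℂ] 𝓢(E, ℂ) :=
  pullback (reflect j).toContinuousLinearEquiv

theorem reflectOp_apply (f : 𝓢(E, ℂ)) (x : E) : reflectOp j f x = f (reflect j x) := rfl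

theorem reflectOp_reflectOp (f : 𝓢(E, ℂ)) : reflectOp j (reflectOp j f) = f := by
  ext x
  rw [reflectOp_apply, reflectOp_apply, reflect_reflect]

/-- The even part with respect to a real coordinate. -/
noncomputable def evenPart : 𝓢(E, ℂ) →L[ℂ] 𝓢(E, ℂ) :=
  (2 : ℂ)⁻¹ • (ContinuousLinearMap.id ℂ _ + reflectOp j)

/-- The odd part with respect to a real coordinate. -/
noncomputable def oddPart : 𝓢(E, ℂ) →L[ℂ] 𝓢(E, ℂ) :=
  (2 : ℂ)⁻¹ • (ContinuousLinearMap.id ℂ _ - reflectOp j)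

theorem evenPart_apply (f : 𝓢(E, ℂ)) : evenPart j f = (2 : ℂ)⁻¹ • (f + reflectOp j f) := rfl

theorem oddPart_apply (f : 𝓢(E, ℂ)) : oddPart j f = (2 : ℂ)⁻¹ • (f - reflectOp j f) := rfl

theorem evenPart_add_oddPart (f : 𝓢(E, ℂ)) : evenPart j f + oddPart j f = f := by
  rw [evenPart_apply, oddPart_apply, ← smul_add, add_add_sub_cancel, ← two_smul ℂ f,
    inv_smul_smul₀ two_ne_zero]

theorem evenPart_oddPart (f : 𝓢(E, ℂ)) : evenPart j (oddPart j f) = 0 := by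
  rw [evenPart_apply, oddPart_apply, map_smul, map_sub, reflectOp_reflectOp]
  module

theorem oddPart_evenPart (f : 𝓢(E, ℂ)) : oddPart j (evenPart j f) = 0 := by
  rw [evenPart_apply, oddPart_apply, map_smul, map_add, reflectOp_reflectOp]
  module

variable {j} in
theorem evenPart_eq_self {f : 𝓢(E, ℂ)} (h : oddPart j f = 0) : evenPart j f = f := by
  simpa [h] using evenPart_add_oddPart j f

/-- An operator that anticommutes with the reflection exchanges even and odd parts. -/
theorem parts_of_anticomm {T : 𝓢(E, ℂ) →L[ℂ] 𝓢(E, ℂ)}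
    (h : ∀ f, reflectOp j (T f) = -T (reflectOp j f)) (f : 𝓢(E, ℂ)) :
    evenPart j (T f) = T (oddPart j f) ∧ oddPart j (T f) = T (evenPart j f) := by
  simp only [evenPart_apply, oddPart_apply, h, map_smul, map_add, map_sub]
  constructor <;> module

theorem parts_of_comm {T : 𝓢(E, ℂ) →L[ℂ] 𝓢(E, ℂ)}
    (h : ∀ f, reflectOp j (T f) = T (reflectOp j f)) (f : 𝓢(E, ℂ)) :
    evenPart j (T f) = T (evenPart j f) ∧ oddPart j (T f) = T (oddPart j f) := by
  simp only [evenPart_apply, oddPart_apply, h, map_smul, map_add, map_sub, and_self]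

theorem oddPart_eq_zero_of_coord {f : 𝓢(E, ℂ)} {x : E} (hx : coord j x = 0) :
    oddPart j f x = 0 := by
  rw [oddPart_apply]
  simp [reflectOp_apply, reflect_of_coord_eq_zero j hx]

theorem reflectOp_mulForm (f : 𝓢(E, ℂ)) :
    reflectOp j (mulForm (realForm j) f) = -mulForm (realForm j) (reflectOp j f) := by
  ext x
  simp [reflectOp_apply, mulForm_apply, realForm_apply, coord_reflect]

theorem reflectOp_dirDeriv (f : 𝓢(E, ℂ)) :
    reflectOp j (dirDeriv (j 1) f) = -dirDeriv (j 1) (reflectOp j f) := by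
  have h := dirDeriv_pullback_real j (L := (reflect j).toContinuousLinearEquiv)
    (reflect_self j) f
  rw [reflectOp, h]
  simp

/-- Division of odd Schwartz functions by a real coordinate. -/
theorem exists_real_division : ∃ N : 𝓢(E, ℂ) →L[ℂ] 𝓢(E, ℂ),
    ∀ f, mulForm (realForm j) (N f) = oddPart j f := by
  have hq : IsScaling (realForm j) (j.toContinuousLinearMap ∘L coord j) :=
    isScaling_coord fun x => by rw [realForm_apply, Complex.norm_real]
  -- The quotient of an odd function by the coordinate is the average of its partial derivative over
  -- the segment to the hyperplane; the exponent of `t` is `0`.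
  obtain ⟨N, -, hN⟩ := hq.exists_division (fun _ => 0) (ι := Unit)
    (isDominated_const (dirDeriv (j 1) ∘L oddPart j)) (isDominated_const (oddPart j)) fun _ f x => by
      set g := oddPart j f with hg
      set γ : ℝ → E := fun t =>
        (ContinuousLinearMap.id ℝ E - (1 - t) • (j.toContinuousLinearMap ∘L coord j)) x with hγ
      have hγ' : ∀ t, HasDerivAt γ (j (coord j x)) t := fun t => by
        have h1 : HasDerivAt (fun t : ℝ => x - (1 - t) • j (coord j x))
            (-((0 - 1 : ℝ) • j (coord j x))) t :=
          ((((hasDerivAt_const t (1 : ℝ)).sub (hasDerivAt_id t)).smul_const _).const_sub x)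
        have h2 : HasDerivAt (fun t : ℝ => x - (1 - t) • j (coord j x)) (j (coord j x)) t := by
          simpa using h1
        exact h2
      have hder : ∀ t, HasDerivAt (fun t => g (γ t))
          (realForm j x * dirDeriv (j 1) g (γ t)) t := fun t => by
        convert! (g.hasFDerivAt (γ t)).comp_hasDerivAt t (hγ' t) using 1
        rw [dirDeriv_apply, realForm_apply, ← Complex.real_smul, ← map_smul, ← map_smul,
          smul_eq_mul, mul_one]
      have hcont : Continuous fun t => realForm j x * dirDeriv (j 1) g (γ t) := by
        have : Continuous γ := continuous_iff_continuousAt.2 fun t => (hγ' t).continuousAt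
        fun_prop
      have h2 := intervalIntegral.integral_eq_sub_of_hasDerivAt (fun t _ => hder t)
        (hcont.intervalIntegrable 0 1)
      -- The segment starts on the fixed hyperplane of the reflection, where odd functions vanish,
      -- so there is no boundary term.
      have h0 : g (γ 0) = 0 := by
        refine oddPart_eq_zero_of_coord j ?_
        simp [hγ, coord_self]
      have h1 : γ 1 = x := by simp [hγ]
      rw [h0, h1, sub_zero, intervalIntegral.integral_const_mul] at h2
      simp only [pow_zero, one_mul]
      exact h2
  refine ⟨N (), fun f => SchwartzMap.ext fun x => ?_⟩
  rw [mulForm_apply]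
  exact hN () f x

variable [MeasurableSpace E] [BorelSpace E]

theorem isFourierMul_real :
    IsFourierMul (dirDeriv (j 1)) (realForm j) (2 * Real.pi * Complex.I) := fun f => by
  ext x
  rw [fourierEquiv_dirDeriv, _root_.smul_apply, mulForm_apply, realForm_apply, ← inner_coord,
    smul_eq_mul, ← mul_assoc]
  simp

/-- The twist of the Schwartz space by a real coordinate is isomorphic to the Schwartz space:
multiply even functions by the coordinate and integrate odd functions. -/
theorem exists_real_twist : ∃ A : 𝓢(E, ℂ) ≃L[ℂ] 𝓢(E, ℂ), ∀ (L : E ≃L[ℝ] E) (a : ℝ),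
    (∀ c, L (j c) = j (a * c)) → (∀ x, coord j (L x) = a * coord j x) →
      ∀ f, A ((a : ℂ) • pullback L f) = pullback L (A f) := by
  obtain ⟨N, hN⟩ := exists_real_division j
  set c : ℂ := 2 * Real.pi * Complex.I
  have hc : c ≠ 0 := Complex.two_pi_I_ne_zero
  set M := mulForm (realForm j) with hM
  set D : 𝓢(E, ℂ) →L[ℂ] 𝓢(E, ℂ) := dirDeriv (j 1) with hD
  set J := fourierConj c N
  have hMinj : Function.Injective M := mulForm_injective (realForm_ne_zero j)
  have hDinj : Function.Injective D := (isFourierMul_real j).injective (realForm_ne_zero j) hc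
  have hMp := parts_of_anticomm j (T := M) (reflectOp_mulForm j)
  have hDp := parts_of_anticomm j (T := D) (reflectOp_dirDeriv j)
  have hFp := parts_of_comm j (T := (fourierEquiv E : 𝓢(E, ℂ) →L[ℂ] 𝓢(E, ℂ)))
    fun f => (fourierEquiv_pullback (reflect j) f).symm
  -- The Fourier transform preserves parity, so that of an odd function is odd and divisible by the
  -- coordinate.
  have hJ : ∀ f, D (J f) = oddPart j f := fun f =>
    (isFourierMul_real j).apply_fourierConj hc ((hN _).trans (hFp f).2)
  -- The derivative exchanges parities and is injective: the odd part of `J f` has derivative the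
  -- even part of an odd function, which is zero.
  have hJodd : ∀ f, oddPart j (J f) = 0 := fun f => hDinj <| by
    rw [← (hDp _).1, hJ, evenPart_oddPart, map_zero]
  have hNodd : ∀ f, oddPart j (N f) = 0 := fun f => hMinj <| by
    rw [← (hMp _).1, hN, evenPart_oddPart, map_zero]
  -- `A` multiplies the even part and integrates the odd part; `B` divides the odd part and
  -- differentiates the even part.
  let A : 𝓢(E, ℂ) →L[ℂ] 𝓢(E, ℂ) := M ∘L evenPart j + J
  let B : 𝓢(E, ℂ) →L[ℂ] 𝓢(E, ℂ) := N + D ∘L evenPart j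
  have hA : ∀ f, A f = M (evenPart j f) + J f := fun _ => rfl
  have hB : ∀ f, B f = N f + D (evenPart j f) := fun _ => rfl
  have hBA : ∀ f, B (A f) = f := fun f => by
    have h1 : evenPart j (A f) = J f := by
      rw [hA, map_add, (hMp _).1, oddPart_evenPart, map_zero, zero_add,
        evenPart_eq_self (hJodd f)]
    have h2 : N (A f) = evenPart j f := hMinj <| by
      rw [hN, hA, map_add, (hMp _).2, hJodd, add_zero, evenPart_eq_self (oddPart_evenPart j f)]
    rw [hB, h1, h2, hJ, evenPart_add_oddPart]
  have hAB : ∀ f, A (B f) = f := fun f => by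
    have h1 : evenPart j (B f) = N f := by
      rw [hB, map_add, (hDp _).1, oddPart_evenPart, map_zero, add_zero,
        evenPart_eq_self (hNodd f)]
    have h2 : J (B f) = evenPart j f := hDinj <| by
      rw [hJ, hB, map_add, (hDp _).2, hNodd, zero_add, evenPart_eq_self (oddPart_evenPart j f)]
    rw [hA, h1, h2, hN, add_comm, evenPart_add_oddPart]
  refine ⟨ContinuousLinearEquiv.equivOfInverse A B hBA hAB, fun L a hL hL' f => ?_⟩
  change A _ = pullback L (A f)
  have hcomm : ∀ f, reflectOp j (pullback L f) = pullback L (reflectOp j f) := fun f => by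
    ext x
    have := actIsometry_comm (B := a • ContinuousLinearMap.id ℝ ℝ) hL hL'
      (A := LinearIsometryEquiv.neg ℝ) (fun c => by simp) x
    exact congrArg f this.symm
  have hLp := parts_of_comm j (T := pullback L) hcomm f
  rw [map_smul, hA, hA, map_add, (hLp).1, pullback_mulForm (realForm_semiconj j hL'), smul_add]
  congr 1
  -- Integration is equivariant because differentiation is: compare derivatives, as `D` is
  -- injective.
  apply hDinj
  rw [map_smul, hJ, hLp.2, hD, dirDeriv_pullback_real j hL, ← hD, hJ]

end RealCoordinate

/-! ### The Wirtinger derivative. -/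

section Wirtinger

variable {E : Type*} [NormedAddCommGroup E] [InnerProductSpace ℝ E] (j : ℂ →ₗᵢ[ℝ] E)

/-- The Wirtinger derivative with respect to a complex coordinate. -/
noncomputable def wirtinger : 𝓢(E, ℂ) →L[ℂ] 𝓢(E, ℂ) :=
  (2 : ℂ)⁻¹ • (dirDeriv (j 1) - Complex.I • dirDeriv (j Complex.I))

theorem wirtinger_apply (f : 𝓢(E, ℂ)) (x : E) : wirtinger j f x =
    2⁻¹ * (fderiv ℝ f x (j 1) - Complex.I * fderiv ℝ f x (j Complex.I)) := by
  simp [wirtinger, dirDeriv_apply]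

theorem map_embed {F : Type*} [AddCommGroup F] [Module ℝ F] [TopologicalSpace F] (Λ : E →L[ℝ] F)
    (z : ℂ) : Λ (j z) = z.re • Λ (j 1) + z.im • Λ (j Complex.I) := by
  rw [← map_smul, ← map_smul, ← map_smul, ← map_smul, ← map_add, ← map_add]
  congr 2
  simp

/-- `L` acts complex linearly on the coordinate, so the chain rule for `∂/∂z` produces the factor
`a` and no conjugate derivative. -/
theorem wirtinger_pullback {L : E ≃L[ℝ] E} {a : ℂ} (hL : ∀ c, L (j c) = j (a * c))
    (f : 𝓢(E, ℂ)) : wirtinger j (pullback L f) = a • pullback L (wirtinger j f) := by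
  ext x
  have h : ∀ v, fderiv ℝ (pullback L f) x v = fderiv ℝ f (L x) (L v) := fun v => by
    rw [← dirDeriv_apply, dirDeriv_pullback]
  rw [wirtinger_apply, h, h, hL, hL, map_embed j _ (a * 1), map_embed j _ (a * Complex.I),
    _root_.smul_apply, pullback_apply, wirtinger_apply]
  simp only [mul_one, Complex.mul_I_re, Complex.mul_I_im, Complex.real_smul, smul_eq_mul,
    Complex.ofReal_neg]
  conv_rhs => rw [← Complex.re_add_im a]
  linear_combination ((2⁻¹ : ℂ) * a.im * fderiv ℝ f (L x) (j Complex.I)) * Complex.I_sq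

/-- Taking `z` to be the coordinate of `x` makes the two terms the radial and the rotational
derivative; the latter is known on functions of a given weight. -/
theorem mul_wirtinger (f : 𝓢(E, ℂ)) (x : E) (z : ℂ) : 2 * z * wirtinger j f x =
    fderiv ℝ f x (j z) - Complex.I * fderiv ℝ f x (j (Complex.I * z)) := by
  rw [wirtinger_apply, map_embed j _ z, map_embed j _ (Complex.I * z)]
  simp only [Complex.I_mul_re, Complex.I_mul_im, Complex.real_smul, Complex.ofReal_neg]
  conv_lhs => rw [← Complex.re_add_im z]
  linear_combination -(z.im * fderiv ℝ f x (j Complex.I)) * Complex.I_sq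

end Wirtinger

/-! ### Rotations of a complex coordinate and the weight decomposition. -/

section ComplexCoordinate

variable {E : Type*} [NormedAddCommGroup E] [InnerProductSpace ℝ E] [FiniteDimensional ℝ E]
  (j : ℂ →ₗᵢ[ℝ] E)

theorem coord_ne_zero : coord j ≠ 0 := fun h => by
  have := congrArg (fun ℓ : E →L[ℝ] ℂ => ℓ (j 1)) h
  simp [coord_self] at this

/-- The rotation of a complex coordinate. -/
noncomputable def turn (w : Circle) : E ≃ₗᵢ[ℝ] E := actIsometry j (rotation w)

theorem turn_apply (w : Circle) (x : E) : turn j w x = x + j (w * coord j x - coord j x) := rfl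

theorem turn_self (w : Circle) (c : ℂ) : turn j w (j c) = j (w * c) := act_self _ c

theorem coord_turn (w : Circle) (x : E) : coord j (turn j w x) = w * coord j x := coord_act _ x

theorem turn_turn (w z : Circle) (x : E) : turn j w (turn j z x) = turn j (w * z) x := by
  rw [turn_apply, coord_turn, turn_apply, turn_apply, add_assoc, ← map_add]
  congr 2
  push_cast
  ring

theorem turn_one (x : E) : turn j 1 x = x := by
  simp [turn_apply]

theorem continuous_turn (x : E) : Continuous fun w => turn j w x := by
  simp only [turn_apply]
  fun_prop

/-- Composition with the rotation of a complex coordinate. -/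
noncomputable def turnOp (w : Circle) : 𝓢(E, ℂ) →L[ℂ] 𝓢(E, ℂ) :=
  pullback (turn j w).toContinuousLinearEquiv

theorem turnOp_apply (w : Circle) (f : 𝓢(E, ℂ)) (x : E) : turnOp j w f x = f (turn j w x) := rfl

/-! ### Weights -/

/-- The function `f` has weight `n` under rotations of a complex coordinate. -/
def HasWeight (n : ℤ) (f : 𝓢(E, ℂ)) : Prop := ∀ w : Circle, turnOp j w f = ((w ^ n : Circle) : ℂ) • f

variable {j}

theorem HasWeight.apply {n : ℤ} {f : 𝓢(E, ℂ)} (h : HasWeight j n f) (w : Circle) (x : E) :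
    f (turn j w x) = ((w ^ n : Circle) : ℂ) * f x :=
  congrArg (fun g : 𝓢(E, ℂ) => g x) (h w)

/-- An injective operator that changes the weight of functions by `k` is compatible with weights. -/
theorem HasWeight.of_injective {T : 𝓢(E, ℂ) →L[ℂ] 𝓢(E, ℂ)} (hT : Function.Injective T) {k : ℤ}
    (h : ∀ w f, T (turnOp j w f) = ((w ^ k : Circle) : ℂ) • turnOp j w (T f)) {n : ℤ}
    {f : 𝓢(E, ℂ)} (hf : HasWeight j n (T f)) : HasWeight j (n + k) f := fun w => hT <| by
  rw [h, hf, map_smul, smul_smul, ← Circle.coe_mul, ← zpow_add, add_comm]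

theorem HasWeight.map {T : 𝓢(E, ℂ) →L[ℂ] 𝓢(E, ℂ)} {k : ℤ}
    (h : ∀ w f, T (turnOp j w f) = ((w ^ k : Circle) : ℂ) • turnOp j w (T f)) {n : ℤ}
    {f : 𝓢(E, ℂ)} (hf : HasWeight j n f) : HasWeight j (n - k) (T f) := fun w => by
  have h1 := h w f
  rw [hf, map_smul] at h1
  have h2 := congrArg (fun g => ((w ^ (-k) : Circle) : ℂ) • g) h1
  simp only [smul_smul, ← Circle.coe_mul, ← zpow_add, neg_add_cancel, zpow_zero,
    Circle.coe_one, one_smul] at h2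
  rw [← h2, sub_eq_add_neg, add_comm]

theorem mulForm_turnOp (w : Circle) (f : 𝓢(E, ℂ)) : mulForm (coord j) (turnOp j w f) =
    ((w ^ (-1 : ℤ) : Circle) : ℂ) • turnOp j w (mulForm (coord j) f) := by
  ext x
  have hw : (w : ℂ) ≠ 0 := Circle.coe_ne_zero w
  simp only [turnOp_apply, mulForm_apply, coord_turn, zpow_neg_one, Circle.coe_inv,
    _root_.smul_apply, smul_eq_mul]
  field_simp

theorem wirtinger_turnOp (w : Circle) (f : 𝓢(E, ℂ)) : wirtinger j (turnOp j w f) =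
    ((w ^ (1 : ℤ) : Circle) : ℂ) • turnOp j w (wirtinger j f) := by
  rw [zpow_one]
  exact wirtinger_pullback j (turn_self j w) f

variable (j) in
/-- The generator of the rotations of a complex coordinate. -/
noncomputable def angular : 𝓢(E, ℂ) →L[ℂ] 𝓢(E, ℂ) :=
  mulForm (Complex.ofRealCLM ∘L Complex.reCLM ∘L coord j) ∘L dirDeriv (j Complex.I) -
    mulForm (Complex.ofRealCLM ∘L Complex.imCLM ∘L coord j) ∘L dirDeriv (j 1)

theorem angular_apply (f : 𝓢(E, ℂ)) (x : E) :
    angular j f x = fderiv ℝ f x (j (Complex.I * coord j x)) := by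
  rw [map_embed j _ (Complex.I * _)]
  simp only [angular, _root_.sub_apply, ContinuousLinearMap.comp_apply, mulForm_apply,
    dirDeriv_apply, Complex.ofRealCLM_apply, Complex.reCLM_apply, Complex.imCLM_apply,
    Complex.I_mul_re, Complex.I_mul_im, Complex.real_smul, Complex.ofReal_neg]
  ring

theorem hasDerivAt_turn (f : 𝓢(E, ℂ)) (x : E) (t : ℝ) :
    HasDerivAt (fun t : ℝ => f (turn j (AddCircle.toCircle (t : UnitAddCircle)) x))
      (2 * Real.pi * angular j f (turn j (AddCircle.toCircle (t : UnitAddCircle)) x)) t := by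
  have h1 : HasDerivAt (fun t : ℝ => ((AddCircle.toCircle (t : UnitAddCircle) : Circle) : ℂ))
      (2 * Real.pi * Complex.I * (AddCircle.toCircle (t : UnitAddCircle) : Circle)) t := by
    have := hasDerivAt_fourier 1 1 t
    simpa [fourier_one] using this
  have h2 : HasDerivAt (fun t : ℝ => turn j (AddCircle.toCircle (t : UnitAddCircle)) x)
      (j (2 * Real.pi * Complex.I * (AddCircle.toCircle (t : UnitAddCircle) : Circle) *
        coord j x)) t := by
    have h3 := ((h1.mul_const (coord j x)).sub_const (coord j x))
    exact ((j.toContinuousLinearMap.hasFDerivAt.comp_hasDerivAt t h3).const_add x)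
  refine ((f.hasFDerivAt _).comp_hasDerivAt t h2).congr_deriv ?_
  rw [angular_apply, coord_turn, show (2 * Real.pi * Complex.I *
    (AddCircle.toCircle (t : UnitAddCircle) : Circle) * coord j x : ℂ) = (2 * Real.pi : ℝ) •
    (Complex.I * ((AddCircle.toCircle (t : UnitAddCircle) : Circle) * coord j x)) by
      rw [Complex.real_smul]; push_cast; ring, map_smul, map_smul, Complex.real_smul]
  push_cast
  rfl

/-- The infinitesimal rotation on functions of a given weight. -/
theorem HasWeight.fderiv_apply {n : ℤ} {f : 𝓢(E, ℂ)} (h : HasWeight j n f) (x : E) :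
    fderiv ℝ f x (j (Complex.I * coord j x)) = Complex.I * n * f x := by
  have h1 := hasDerivAt_turn (j := j) f x 0
  have h2 : (fun t : ℝ => f (turn j (AddCircle.toCircle (t : UnitAddCircle)) x)) =
      fun t : ℝ => fourier n (t : UnitAddCircle) * f x := by
    funext t
    rw [h.apply, fourier_apply, AddCircle.toCircle_zsmul]
  rw [h2] at h1
  have h3 := h1.unique ((hasDerivAt_fourier 1 n 0).mul_const (f x))
  rw [AddCircle.coe_zero, AddCircle.toCircle_zero, turn_one, fourier_eval_zero,
    angular_apply] at h3
  have hpi : (2 * Real.pi : ℂ) ≠ 0 := by simp [Real.pi_ne_zero]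
  refine mul_left_cancel₀ hpi (h3.trans ?_)
  push_cast
  ring

/-! ### Projection to functions of a given weight -/

theorem isContractionFamily_turn (n : ℤ) : IsContractionFamily
    (fun t => fourier (-n) (t : UnitAddCircle))
    fun t => ((turn j (AddCircle.toCircle (t : UnitAddCircle))).toContinuousLinearEquiv :
      E →L[ℝ] E) where
  continuous_weight := (fourier (-n)).continuous.comp (AddCircle.continuous_mk' _)
  continuous_map := by
    have h : ∀ w : Circle, ((turn j w).toContinuousLinearEquiv : E →L[ℝ] E) =
        act j (ContinuousLinearMap.mul ℝ ℂ w) := fun w => rfl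
    have hw : Continuous fun t : ℝ => ((AddCircle.toCircle (t : UnitAddCircle) : Circle) : ℂ) :=
      continuous_induced_dom.comp
        (AddCircle.continuous_toCircle.comp (AddCircle.continuous_mk' _))
    simp only [h, act]
    fun_prop
  norm_weight_le t _ := by
    rw [fourier_apply, Circle.norm_coe]
  norm_map_le t _ := LinearIsometry.norm_toContinuousLinearMap_le (turn j _).toLinearIsometry

-- Rotations are isometries, so `‖x‖ ^ k` is constant along orbits and averaging over an orbit does
-- not increase any Schwartz seminorm, whatever the weight.
variable (j) in
theorem exists_weightPart : ∃ P : ℤ → 𝓢(E, ℂ) →L[ℂ] 𝓢(E, ℂ), IsDominated (fun _ => 1) P ∧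
    ∀ n f x, P n f x = ∫ t in (0 : ℝ)..1, fourier (-n) (t : UnitAddCircle) *
      f (turn j (AddCircle.toCircle (t : UnitAddCircle)) x) := by
  have hb : ∀ (n : ℤ) (f : 𝓢(E, ℂ)) (k m : ℕ) (x : E), ‖x‖ ^ k * ‖iteratedFDeriv ℝ m
      (fun x => ∫ t in (0 : ℝ)..1, fourier (-n) (t : UnitAddCircle) *
        f (turn j (AddCircle.toCircle (t : UnitAddCircle)) x)) x‖ ≤
        SchwartzMap.seminorm ℂ k m f := by
    intro n f k m x
    rcases (pow_nonneg (norm_nonneg x) k).eq_or_lt with h0 | h0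
    · rw [← h0, zero_mul]
      exact apply_nonneg _ _
    · rw [mul_comm, ← le_div_iff₀ h0]
      refine (isContractionFamily_turn n).norm_iteratedFDeriv_average_le f m x fun t _ => ?_
      rw [le_div_iff₀ h0, mul_comm]
      have := f.le_seminorm ℂ k m (turn j (AddCircle.toCircle (t : UnitAddCircle)) x)
      rwa [LinearIsometryEquiv.norm_map] at this
  have hP : ∀ n, ∃ P : 𝓢(E, ℂ) →L[ℂ] 𝓢(E, ℂ), ∀ f x, P f x =
      ∫ t in (0 : ℝ)..1, fourier (-n) (t : UnitAddCircle) *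
        f (turn j (AddCircle.toCircle (t : UnitAddCircle)) x) := fun n =>
    exists_clm_of_le_seminorm _ (fun f g x => (isContractionFamily_turn n).average_add f g x)
      (fun a f x => IsContractionFamily.average_smul
        (L := fun t => ((turn j (AddCircle.toCircle (t : UnitAddCircle))).toContinuousLinearEquiv :
          E →L[ℝ] E)) f a x)
      (fun f => (isContractionFamily_turn n).contDiff_average f)
      fun k m => ⟨_, continuous_schwartzSeminorm k m, fun f x => hb n f k m x⟩
  choose P hP using hP
  refine ⟨P, fun k m => ⟨_, continuous_schwartzSeminorm k m, fun n f => ?_⟩, hP⟩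
  refine SchwartzMap.seminorm_le_bound ℂ k m _ (by simp) fun x => ?_
  rw [funext (hP n f), one_mul]
  exact hb n f k m x

variable (j) in
/-- The projection to the Schwartz functions of weight `n`. -/
noncomputable def weightPart : ℤ → 𝓢(E, ℂ) →L[ℂ] 𝓢(E, ℂ) := (exists_weightPart j).choose

theorem isDominated_weightPart : IsDominated (fun _ => 1) (weightPart j) :=
  (exists_weightPart j).choose_spec.1

theorem weightPart_apply (n : ℤ) (f : 𝓢(E, ℂ)) (x : E) : weightPart j n f x =
    ∫ t in (0 : ℝ)..1, fourier (-n) (t : UnitAddCircle) *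
      f (turn j (AddCircle.toCircle (t : UnitAddCircle)) x) :=
  (exists_weightPart j).choose_spec.2 n f x

variable (j) in
/-- The restriction of a Schwartz function to an orbit of the rotations. -/
noncomputable def orbit (f : 𝓢(E, ℂ)) (x : E) : C(UnitAddCircle, ℂ) where
  toFun s := f (turn j (AddCircle.toCircle s) x)
  continuous_toFun := f.continuous.comp ((continuous_turn j x).comp AddCircle.continuous_toCircle)

/-- Reduces the weight decomposition to Fourier series of continuous functions on the circle. -/
theorem weightPart_eq_fourierCoeff (n : ℤ) (f : 𝓢(E, ℂ)) (x : E) :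
    weightPart j n f x = fourierCoeff (orbit j f x) n := by
  rw [weightPart_apply, fourierCoeff_eq_intervalIntegral _ _ 0]
  simp [orbit]

/-- Rotating `x` translates the variable of integration; invariance of Haar measure leaves only the
value of the character. -/
theorem hasWeight_weightPart (n : ℤ) (f : 𝓢(E, ℂ)) : HasWeight j n (weightPart j n f) := by
  intro w
  obtain ⟨s, rfl⟩ : ∃ s : UnitAddCircle, AddCircle.toCircle s = w :=
    ((AddCircle.homeomorphCircle one_ne_zero).surjective w).imp fun s h => by
      rwa [AddCircle.homeomorphCircle_apply] at h
  ext x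
  rw [turnOp_apply, _root_.smul_apply, weightPart_eq_fourierCoeff, weightPart_eq_fourierCoeff,
    ← AddCircle.toCircle_zsmul, ← fourier_apply, smul_eq_mul, fourierCoeff, fourierCoeff,
    ← integral_const_mul,
    ← integral_add_right_eq_self (fun t => _ * (fourier (-n) t • orbit j f x t)) s]
  congr 1
  funext t
  simp only [orbit, ContinuousMap.coe_mk, turn_turn, ← AddCircle.toCircle_add, smul_eq_mul,
    ← mul_assoc]
  congr 1
  rw [fourier_apply, fourier_apply, fourier_apply, smul_add, AddCircle.toCircle_add,
    Circle.coe_mul, mul_left_comm, ← Circle.coe_mul, ← AddCircle.toCircle_add]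
  simp

theorem HasWeight.weightPart_eq {m : ℤ} {f : 𝓢(E, ℂ)} (h : HasWeight j m f) (n : ℤ) :
    weightPart j n f = if n = m then f else 0 := by
  ext x
  have h1 : (orbit j f x : UnitAddCircle → ℂ) = fun t => f x * fourier m t := by
    funext t
    simp only [orbit, ContinuousMap.coe_mk]
    rw [h.apply, fourier_apply, AddCircle.toCircle_zsmul, mul_comm]
  rw [weightPart_eq_fourierCoeff, h1, fourierCoeff.const_mul, fourierCoeff_fourier]
  split_ifs with h2 <;> simp [h2]

theorem HasWeight.weightPart_self {m : ℤ} {f : 𝓢(E, ℂ)} (h : HasWeight j m f) :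
    weightPart j m f = f := by
  rw [h.weightPart_eq, if_pos rfl]

/-- A Schwartz function is determined by its parts of all weights. -/
theorem ext_weightPart {f g : 𝓢(E, ℂ)} (h : ∀ n, weightPart j n f = weightPart j n g) : f = g := by
  rw [← sub_eq_zero]
  ext x
  have h0 : fourierCoeff (orbit j (f - g) x) = 0 := by
    funext n
    rw [← weightPart_eq_fourierCoeff, map_sub, h, sub_self]
    rfl
  -- With all coefficients zero the Fourier series is summable, so it represents the continuous
  -- orbit function, here at the identity rotation.
  have h1 := has_pointwise_sum_fourier_series_of_summable (f := orbit j (f - g) x)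
    (by rw [h0]; exact summable_zero) 0
  rw [h0] at h1
  simp only [Pi.zero_apply, zero_smul] at h1
  have h2 := h1.unique hasSum_zero
  simpa [orbit, turn_one] using h2

theorem weightPart_comm {L : E ≃L[ℝ] E} {a : ℂ} (hL : ∀ c, L (j c) = j (a * c))
    (hL' : ∀ x, coord j (L x) = a * coord j x) (n : ℤ) (f : 𝓢(E, ℂ)) :
    weightPart j n (pullback L f) = pullback L (weightPart j n f) := by
  ext x
  rw [pullback_apply, weightPart_apply, weightPart_apply]
  congr 1
  funext t
  congr 1
  rw [pullback_apply]
  congr 1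
  exact (actIsometry_comm (B := ContinuousLinearMap.mul ℝ ℂ a) hL hL'
    (fun c => mul_left_comm _ _ _) x).symm

/-- Integration by parts over the closed orbit; the boundary terms cancel by periodicity. -/
theorem weightPart_angular (n : ℤ) (f : 𝓢(E, ℂ)) :
    weightPart j n (angular j f) = (Complex.I * n) • weightPart j n f := by
  ext x
  rw [_root_.smul_apply, weightPart_apply, weightPart_apply]
  set g : ℝ → ℂ := fun t => f (turn j (AddCircle.toCircle (t : UnitAddCircle)) x) with hg
  set g' : ℝ → ℂ := fun t => angular j f (turn j (AddCircle.toCircle (t : UnitAddCircle)) x)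
    with hg'
  set e : ℝ → ℂ := fun t => fourier (-n) (t : UnitAddCircle) with he
  have hec : Continuous e := (isContractionFamily_turn (j := j) n).continuous_weight
  have h1 : Continuous fun t => e t * g t := (isContractionFamily_turn n).continuous_weighted f x
  have h2 : Continuous fun t => e t * g' t :=
    (isContractionFamily_turn n).continuous_weighted (angular j f) x
  have hd : ∀ t, HasDerivAt (fun t => e t * g t)
      (2 * Real.pi * (e t * g' t) - 2 * Real.pi * (Complex.I * n) * (e t * g t)) t := fun t => by
    refine ((hasDerivAt_fourier_neg 1 n t).mul (hasDerivAt_turn f x t)).congr_deriv ?_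
    simp only [he, hg, hg']
    push_cast
    ring
  have h3 := intervalIntegral.integral_eq_sub_of_hasDerivAt (fun t _ => hd t)
    (((h2.const_mul _).sub (h1.const_mul _)).intervalIntegrable 0 1)
  rw [intervalIntegral.integral_sub ((h2.const_mul _).intervalIntegrable _ _)
    ((h1.const_mul _).intervalIntegrable _ _), intervalIntegral.integral_const_mul,
    intervalIntegral.integral_const_mul] at h3
  have h01 : ((1 : ℝ) : UnitAddCircle) = ((0 : ℝ) : UnitAddCircle) := by
    rw [AddCircle.coe_period, AddCircle.coe_zero]
  have h4 : e 1 * g 1 - e 0 * g 0 = 0 := by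
    simp only [he, hg, h01, sub_self]
  rw [h4] at h3
  have hpi : (2 * Real.pi : ℂ) ≠ 0 := by simp [Real.pi_ne_zero]
  refine mul_left_cancel₀ hpi ?_
  rw [smul_eq_mul, ← mul_assoc]
  exact sub_eq_zero.1 h3

/-- On weight `n` the operator `1 - angular ^ 2` is multiplication by `1 + n ^ 2`, so the uniform
bound applied to `f - angular (angular f)` gains this factor. -/
theorem isDominated_weightPart_sq :
    IsDominated (fun n : ℤ => (1 + (n : ℝ) ^ 2)⁻¹) (weightPart j) := by
  intro k m
  obtain ⟨q, hq, h⟩ := (isDominated_weightPart (j := j)).comp_right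
    (ContinuousLinearMap.id ℂ _ - angular j ∘L angular j) k m
  refine ⟨q, hq, fun n f => ?_⟩
  have h1 := h n f
  have h2 : (weightPart j n ∘L (ContinuousLinearMap.id ℂ _ - angular j ∘L angular j)) f =
      ((1 + (n : ℝ) ^ 2 : ℝ) : ℂ) • weightPart j n f := by
    simp only [ContinuousLinearMap.comp_apply, _root_.sub_apply, ContinuousLinearMap.id_apply,
      map_sub, weightPart_angular, smul_smul]
    have : Complex.I * n * (Complex.I * n) = -((n : ℂ) ^ 2) := by
      linear_combination (n : ℂ) ^ 2 * Complex.I_sq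
    rw [this]
    push_cast
    module
  have hn : (0 : ℝ) < 1 + (n : ℝ) ^ 2 := by positivity
  rw [h2, map_smul_eq_mul, Complex.norm_of_nonneg hn.le, one_mul] at h1
  rwa [inv_mul_eq_div, le_div_iff₀ hn, mul_comm]

end ComplexCoordinate

/-! ### The twist by a complex coordinate. -/

section ComplexTwist

variable {E : Type*} [NormedAddCommGroup E] [InnerProductSpace ℝ E] [FiniteDimensional ℝ E]
  {j : ℂ →ₗᵢ[ℝ] E}

/-- The quotient of a function of positive weight by the coordinate is an average of its Wirtinger
derivative. -/
theorem HasWeight.coord_mul_average {k : ℕ} {h : 𝓢(E, ℂ)} (hw : HasWeight j (k + 1) h) (x : E) :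
    coord j x * ∫ t in (0 : ℝ)..1, (t : ℂ) ^ (k + 1) * ((2 : ℂ) • wirtinger j h)
      ((ContinuousLinearMap.id ℝ E - (1 - t) • (j.toContinuousLinearMap ∘L coord j)) x) = h x := by
  set z := coord j x with hz
  set γ : ℝ → E := fun t =>
    (ContinuousLinearMap.id ℝ E - (1 - t) • (j.toContinuousLinearMap ∘L coord j)) x with hγ
  have hγt : ∀ t, γ t = x - (1 - t) • j z := fun t => rfl
  have hcoord : ∀ t, coord j (γ t) = t * z := fun t => by
    rw [hγt, map_sub, map_smul, coord_self, ← hz, Complex.real_smul]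
    push_cast
    ring
  have hγ' : ∀ t, HasDerivAt γ (j z) t := fun t => by
    have h1 : HasDerivAt (fun t : ℝ => x - (1 - t) • j z) (-((0 - 1 : ℝ) • j z)) t :=
      ((((hasDerivAt_const t (1 : ℝ)).sub (hasDerivAt_id t)).smul_const _).const_sub x)
    have h2 : HasDerivAt (fun t : ℝ => x - (1 - t) • j z) (j z) t := by
      simpa using h1
    exact h2
  have hγc : Continuous γ := continuous_iff_continuousAt.2 fun t => (hγ' t).continuousAt
  have hpow : ∀ t : ℝ, HasDerivAt (fun t : ℝ => (t : ℂ) ^ (k + 1)) ((k + 1) * (t : ℂ) ^ k) t :=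
    fun t => by
      simpa using (Complex.ofRealCLM.hasDerivAt (x := t)).fun_pow (k + 1)
  -- The weight turns the derivative of `t ^ (k + 1)` into a rotational derivative, which together
  -- with the radial derivative of `h` makes `2 z ∂h/∂z`. The identity is obtained after multiplying
  -- by `t`, hence only on the open interval.
  have hder : ∀ t ∈ Set.Ioo (0 : ℝ) 1, HasDerivAt (fun t : ℝ => (t : ℂ) ^ (k + 1) * h (γ t))
      (z * ((t : ℂ) ^ (k + 1) * ((2 : ℂ) • wirtinger j h) (γ t))) t := fun t ht => by
    refine ((hpow t).mul ((h.hasFDerivAt (γ t)).comp_hasDerivAt t (hγ' t))).congr_deriv ?_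
    have ht0 : (t : ℂ) ≠ 0 := Complex.ofReal_ne_zero.2 ht.1.ne'
    have h1 := mul_wirtinger j h (γ t) z
    have h2 := hw.fderiv_apply (γ t)
    rw [hcoord, mul_left_comm, ← Complex.real_smul, map_smul, map_smul, Complex.real_smul] at h2
    refine mul_left_cancel₀ ht0 ?_
    rw [_root_.smul_apply, smul_eq_mul, Function.comp_apply]
    push_cast at h2
    linear_combination -(t : ℂ) ^ (k + 2) * h1 + Complex.I * (t : ℂ) ^ (k + 1) * h2 +
      (t : ℂ) ^ (k + 1) * (k + 1) * h (γ t) * Complex.I_sq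
  have hcont : Continuous fun t : ℝ => (t : ℂ) ^ (k + 1) * h (γ t) := by fun_prop
  have hcont' : Continuous fun t : ℝ =>
      z * ((t : ℂ) ^ (k + 1) * ((2 : ℂ) • wirtinger j h) (γ t)) := by fun_prop
  have h2 := intervalIntegral.integral_eq_sub_of_hasDerivAt_of_le zero_le_one
    hcont.continuousOn hder (hcont'.intervalIntegrable 0 1)
  have h1 : γ 1 = x := by simp [hγt]
  rw [intervalIntegral.integral_const_mul, h1] at h2
  -- The boundary term at `0` vanishes because the exponent `k + 1` is positive.
  simp only [Complex.ofReal_one, one_pow, one_mul, Complex.ofReal_zero,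
    zero_pow k.succ_ne_zero, zero_mul, sub_zero] at h2
  exact h2

/-- Division of Schwartz functions of positive weight by a complex coordinate. -/
theorem exists_complex_division (j : ℂ →ₗᵢ[ℝ] E) : ∃ N : ℕ → 𝓢(E, ℂ) →L[ℂ] 𝓢(E, ℂ),
    IsDominated (fun _ => 1) N ∧
      ∀ k f, mulForm (coord j) (N k f) = weightPart j ((k : ℤ) + 1) f := by
  have hq : IsScaling (coord j) (j.toContinuousLinearMap ∘L coord j) :=
    isScaling_coord fun _ => rfl
  have hG : IsDominated (fun _ => 1) fun k : ℕ => weightPart j ((k : ℤ) + 1) :=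
    isDominated_weightPart.reindex fun k : ℕ => (k : ℤ) + 1
  obtain ⟨N, hN, h⟩ := hq.exists_division (fun k => k + 1)
    (hG.comp_left ((2 : ℂ) • wirtinger j)) hG fun k f x =>
      (hasWeight_weightPart ((k : ℤ) + 1) f).coord_mul_average x
  refine ⟨N, hN, fun k f => SchwartzMap.ext fun x => ?_⟩
  rw [mulForm_apply]
  exact h k f x

/-- The complex conjugate of a complex coordinate. -/
noncomputable def conjEmbed {E : Type*} [NormedAddCommGroup E] [InnerProductSpace ℝ E]
    (j : ℂ →ₗᵢ[ℝ] E) : ℂ →ₗᵢ[ℝ] E :=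
  j.comp Complex.conjLIE.toLinearIsometry

theorem conjEmbed_apply {E : Type*} [NormedAddCommGroup E] [InnerProductSpace ℝ E]
    (j : ℂ →ₗᵢ[ℝ] E) (c : ℂ) : conjEmbed j c = j (conj c) := rfl

theorem coord_conjEmbed (x : E) : coord (conjEmbed j) x = conj (coord j x) := by
  refine ext_inner_left ℝ fun c => ?_
  rw [inner_coord, conjEmbed_apply, ← inner_coord]
  simp [Complex.inner]

theorem turn_conjEmbed (w : Circle) (x : E) : turn (conjEmbed j) w x = turn j w⁻¹ x := by
  rw [turn_apply, turn_apply, conjEmbed_apply, coord_conjEmbed, map_sub, map_mul,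
    Complex.conj_conj, Circle.coe_inv_eq_conj]

/-- Lets division in positive weights also divide functions of negative weight by the conjugate
coordinate. -/
theorem HasWeight.conjEmbed {n : ℤ} {f : 𝓢(E, ℂ)} (h : HasWeight j n f) :
    HasWeight (conjEmbed j) (-n) f := fun w => by
  rw [← inv_zpow', ← h]
  ext x
  rw [turnOp_apply, turn_conjEmbed, turnOp_apply]

theorem summable_inv_one_add_sq : Summable fun n : ℤ => (1 + (n : ℝ) ^ 2)⁻¹ := by
  refine Summable.of_norm_bounded_eventually (Real.summable_one_div_int_pow.2 one_lt_two) ?_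
  rw [Filter.eventually_cofinite]
  refine (Set.finite_singleton (0 : ℤ)).subset fun n hn => ?_
  by_contra h0
  refine hn ?_
  have : (0 : ℝ) < (n : ℝ) ^ 2 := by
    have : (n : ℝ) ≠ 0 := Int.cast_ne_zero.2 h0
    positivity
  rw [Real.norm_of_nonneg (by positivity), one_div]
  exact inv_anti₀ this (by linarith)

/-- Assemble an operator that shifts weights by `s` from its components of given weights. -/
theorem exists_sum_weightPart {T : ℤ → 𝓢(E, ℂ) →L[ℂ] 𝓢(E, ℂ)} (hT : IsDominated (fun _ => 1) T)
    {s : ℤ} (hs : ∀ n f, HasWeight j n f → HasWeight j (n + s) (T n f)) :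
    ∃ S : 𝓢(E, ℂ) →L[ℂ] 𝓢(E, ℂ), ∀ n f,
      weightPart j (n + s) (S f) = T n (weightPart j n f) := by
  obtain ⟨S, hS⟩ := (isDominated_weightPart_sq.comp_bounded hT).exists_hasSum
    summable_inv_one_add_sq
  refine ⟨S, fun n f => ((hS f).mapL (weightPart j (n + s))).unique ?_⟩
  -- In the sum of all `T m (weightPart j m f)`, only the term `m = n` has weight `n + s`.
  have h1 : ∀ m, weightPart j (n + s) (T m (weightPart j m f)) =
      if m = n then T n (weightPart j n f) else 0 := fun m => by
    rw [(hs m _ (hasWeight_weightPart m f)).weightPart_eq]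
    rcases eq_or_ne m n with rfl | h
    · simp
    · rw [if_neg (by omega), if_neg h]
  have h2 := hasSum_ite_eq n (T n (weightPart j n f))
  rw [← funext h1] at h2
  exact h2

variable [MeasurableSpace E] [BorelSpace E]

theorem HasWeight.fourierEquiv {n : ℤ} {f : 𝓢(E, ℂ)} (h : HasWeight j n f) :
    HasWeight j n (fourierEquiv E f) := fun w => by
  rw [turnOp, ← fourierEquiv_pullback, ← map_smul, ← h]
  rfl

/-- The symbol of `∂/∂z` is half of `2πi (re ζ - i im ζ)`, which is `πi` times the conjugate of the
coordinate `ζ`. So antiderivatives come from division by the conjugate. -/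
theorem isFourierMul_wirtinger :
    IsFourierMul (wirtinger j) (coord (conjEmbed j)) (Real.pi * Complex.I) := fun f => by
  ext x
  have h : wirtinger j f = (2 : ℂ)⁻¹ • (dirDeriv (j 1) f - Complex.I • dirDeriv (j Complex.I) f) :=
    rfl
  rw [h, map_smul, map_sub, map_smul]
  simp only [_root_.smul_apply, _root_.sub_apply, fourierEquiv_dirDeriv, mulForm_apply,
    coord_conjEmbed, ← inner_coord, smul_eq_mul]
  have h1 : (⟪(1 : ℂ), coord j x⟫ : ℝ) = (coord j x).re := by simp [Complex.inner]
  have h2 : (⟪Complex.I, coord j x⟫ : ℝ) = (coord j x).im := by simp [Complex.inner]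
  rw [h1, h2]
  conv_rhs => rw [← Complex.re_add_im (coord j x)]
  simp only [map_add, map_mul, Complex.conj_ofReal, Complex.conj_I]
  ring

/-- Antiderivatives of Schwartz functions of negative weight with respect to the Wirtinger
derivative. -/
theorem exists_complex_antideriv (j : ℂ →ₗᵢ[ℝ] E) : ∃ T : ℕ → 𝓢(E, ℂ) →L[ℂ] 𝓢(E, ℂ),
    IsDominated (fun _ => 1) T ∧
      ∀ (k : ℕ) f, HasWeight j (-((k : ℤ) + 1)) f → wirtinger j (T k f) = f := by
  obtain ⟨N, hN, h⟩ := exists_complex_division (conjEmbed j)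
  have hc : (Real.pi * Complex.I : ℂ) ≠ 0 := by simp [Real.pi_ne_zero]
  refine ⟨fun k => fourierConj (Real.pi * Complex.I) (N k), ?_, fun k f hf => ?_⟩
  · exact (hN.comp_right (fourierEquiv E : 𝓢(E, ℂ) →L[ℂ] 𝓢(E, ℂ))).comp_left
      ((Real.pi * Complex.I : ℂ)⁻¹ •
        ((fourierEquiv E).symm : 𝓢(E, ℂ) →L[ℂ] 𝓢(E, ℂ)))
  · refine isFourierMul_wirtinger.apply_fourierConj hc ((h _ _).trans ?_)
    have := hf.fourierEquiv.conjEmbed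
    rw [neg_neg] at this
    exact this.weightPart_self

theorem wirtinger_injective : Function.Injective (wirtinger j) :=
  isFourierMul_wirtinger.injective (coord_ne_zero _) (by simp [Real.pi_ne_zero])

/-- The twist of the Schwartz space by a complex coordinate is isomorphic to the Schwartz space:
multiply functions of nonnegative weights by the coordinate and integrate functions of negative
weights with respect to the Wirtinger derivative. -/
theorem exists_complex_twist (j : ℂ →ₗᵢ[ℝ] E) : ∃ A : 𝓢(E, ℂ) ≃L[ℂ] 𝓢(E, ℂ),
    ∀ (L : E ≃L[ℝ] E) (a : ℂ), (∀ c, L (j c) = j (a * c)) →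
      (∀ x, coord j (L x) = a * coord j x) →
        ∀ f, A (a • pullback L f) = pullback L (A f) := by
  obtain ⟨N, hNd, hN⟩ := exists_complex_division j
  obtain ⟨J, hJd, hJ⟩ := exists_complex_antideriv j
  set M := mulForm (coord j) with hM
  set D : 𝓢(E, ℂ) →L[ℂ] 𝓢(E, ℂ) := wirtinger j with hD
  have hMinj : Function.Injective M := mulForm_injective (coord_ne_zero j)
  have hDinj : Function.Injective D := wirtinger_injective
  -- `T n` raises the weight from `n` to `n + 1`. Since `J k` integrates functions of weight `-(k +
  -- 1)`, the index is `k = -n - 1`.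
  obtain ⟨T, hTM, hTJ, hTd⟩ : ∃ T : ℤ → 𝓢(E, ℂ) →L[ℂ] 𝓢(E, ℂ), (∀ n, 0 ≤ n → T n = M) ∧
      (∀ n, n < 0 → T n = J (-n - 1).toNat) ∧ IsDominated (fun _ => 1) T :=
    ⟨_, fun n hn => if_pos hn, fun n hn => if_neg hn.not_ge, (isDominated_const M).ite
      (hJd.reindex fun n : ℤ => (-n - 1).toNat) fun _ => zero_le_one⟩
  -- `S (n + 1)` is to invert `T n`, so the cases split at `0 < n` rather than `0 ≤ n`; `N k`
  -- divides weight `k + 1`, whence `k = n - 1`.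
  obtain ⟨S, hSN, hSD, hSd⟩ : ∃ S : ℤ → 𝓢(E, ℂ) →L[ℂ] 𝓢(E, ℂ),
      (∀ n, 0 < n → S n = N (n - 1).toNat) ∧ (∀ n, n ≤ 0 → S n = D) ∧
        IsDominated (fun _ => 1) S :=
    ⟨_, fun n hn => if_pos hn, fun n hn => if_neg hn.not_gt,
      (hNd.reindex fun n : ℤ => (n - 1).toNat).ite (isDominated_const D) fun _ => zero_le_one⟩
  have hDT : ∀ n f, n < 0 → HasWeight j n f → D (T n f) = f := fun n f hn hf => by
    rw [hTJ n hn]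
    refine hJ _ _ ?_
    rwa [show -(((-n - 1).toNat : ℤ) + 1) = n by omega]
  have hMS : ∀ n f, 0 < n → HasWeight j n f → M (S n f) = f := fun n f hn hf => by
    rw [hSN n hn, hN, show (((n - 1).toNat : ℤ) + 1) = n by omega, hf.weightPart_self]
  have hMw : ∀ n f, HasWeight j n f → HasWeight j (n + 1) (M f) := fun n f hf => by
    simpa using hf.map mulForm_turnOp
  have hDw : ∀ n f, HasWeight j n f → HasWeight j (n + -1) (D f) := fun n f hf =>
    hf.map wirtinger_turnOp
  have hTw : ∀ n f, HasWeight j n f → HasWeight j (n + 1) (T n f) := fun n f hf => by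
    rcases lt_or_ge n 0 with hn | hn
    · refine HasWeight.of_injective hDinj wirtinger_turnOp ?_
      rwa [hDT n f hn hf]
    · rw [hTM n hn]
      exact hMw n f hf
  have hSw : ∀ n f, HasWeight j n f → HasWeight j (n + -1) (S n f) := fun n f hf => by
    rcases lt_or_ge 0 n with hn | hn
    · refine HasWeight.of_injective hMinj mulForm_turnOp ?_
      rwa [hMS n f hn hf]
    · rw [hSD n hn]
      exact hDw n f hf
  have hST : ∀ n f, HasWeight j n f → S (n + 1) (T n f) = f := fun n f hf => by
    rcases lt_or_ge n 0 with hn | hn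
    · rw [hSD _ (by omega), hDT n f hn hf]
    · apply hMinj
      rw [hMS _ _ (by omega) (hTw n f hf), hTM n hn]
  have hTS : ∀ n f, HasWeight j n f → T (n + -1) (S n f) = f := fun n f hf => by
    rcases lt_or_ge 0 n with hn | hn
    · rw [hTM _ (by omega), hMS n f hn hf]
    · apply hDinj
      rw [hDT _ _ (by omega) (hSw n f hf), hSD n hn]
  obtain ⟨A, hA⟩ := exists_sum_weightPart hTd hTw
  obtain ⟨B, hB⟩ := exists_sum_weightPart hSd hSw
  have hBA : ∀ f, B (A f) = f := fun f => ext_weightPart (j := j) fun n => by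
    have h1 := hB (n + 1) (A f)
    rw [add_neg_cancel_right] at h1
    rw [h1, hA, hST _ _ (hasWeight_weightPart n f)]
  have hAB : ∀ f, A (B f) = f := fun f => ext_weightPart (j := j) fun n => by
    have h1 := hA (n + -1) (B f)
    rw [neg_add_cancel_right] at h1
    rw [h1, hB, hTS _ _ (hasWeight_weightPart n f)]
  refine ⟨ContinuousLinearEquiv.equivOfInverse A B hBA hAB, fun L a hL hL' f => ?_⟩
  change A _ = pullback L (A f)
  have hLw : ∀ n g, HasWeight j n g → HasWeight j n (pullback L g) := fun n g hg w => by
    ext x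
    have h1 : turn j w (L x) = L (turn j w x) :=
      actIsometry_comm (B := ContinuousLinearMap.mul ℝ ℂ a) hL hL'
        (fun c => mul_left_comm _ _ _) x
    rw [turnOp_apply, pullback_apply, ← h1, hg.apply]
    rfl
  refine ext_weightPart (j := j) fun n => ?_
  -- The part of weight `n` of `A g` comes only from weight `n - 1`, so equivariance is checked for
  -- one `T` at a time.
  have h1 : ∀ g, weightPart j n (A g) = T (n + -1) (weightPart j (n + -1) g) := fun g => by
    rw [← hA, neg_add_cancel_right]
  rw [h1, weightPart_comm hL hL', h1, map_smul, weightPart_comm hL hL', map_smul]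
  have hw := hasWeight_weightPart (j := j) (n + -1) f
  set g := weightPart j (n + -1) f
  rcases lt_or_ge (n + -1) 0 with hn | hn
  · apply hDinj
    rw [map_smul, hDT _ _ hn (hLw _ _ hw), hD, wirtinger_pullback j hL, ← hD, hDT _ _ hn hw]
  · rw [hTM _ hn, hM, pullback_mulForm hL']

end ComplexTwist

/-! ### Characters of the infinite ideles that can be absorbed by an automorphism. -/

section Twists

open NumberField

variable {K : Type*} [Field K] [IsGlobalField K]

variable (K) in
/-- The functions `χ` on `𝔸_∞` for which the representations of `𝔸_K^×` on `𝓢(𝔸_∞)` by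
`f ↦ f(x g)` and by `f ↦ χ(g) f(x g)` are isomorphic. -/
noncomputable def twists : Submonoid (InfAdele K → ℂ) where
  carrier := {χ | ∃ A : 𝓢(InfAdele K, ℂ) ≃L[ℂ] 𝓢(InfAdele K, ℂ), ∀ (g : (Adele K)ˣ) f,
    A (χ (g : Adele K).1 • pullback (infMul g) f) = pullback (infMul g) (A f)}
  one_mem' := ⟨ContinuousLinearEquiv.refl ℂ _, fun g f => one_smul ℂ (pullback (infMul g) f)⟩
  mul_mem' := by
    rintro χ ψ ⟨A, hA⟩ ⟨B, hB⟩
    refine ⟨A.trans B, fun g f => ?_⟩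
    rw [ContinuousLinearEquiv.trans_apply, ContinuousLinearEquiv.trans_apply, ← hB, ← hA,
      Pi.mul_apply, mul_comm, mul_smul, map_smul]

variable (K) in
/-- The space `𝔸_∞` with the Euclidean norm. -/
abbrev EuclideanInfAdele : Type _ :=
  WithLp 2 (EuclideanSpace ℝ {w : InfinitePlace K // w.IsReal} ×
    EuclideanSpace ℂ {w : InfinitePlace K // w.IsComplex})

instance : FiniteDimensional ℝ (EuclideanInfAdele K) :=
  ((WithLp.linearEquiv 2 ℝ _).trans ((WithLp.linearEquiv 2 ℝ _).prodCongr
    (WithLp.linearEquiv 2 ℝ _))).symm.finiteDimensional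

variable (K) in
/-- The identity map from `𝔸_∞` with the Euclidean norm to `𝔸_∞`. -/
noncomputable def ofEuclidean : EuclideanInfAdele K ≃L[ℝ] InfAdele K :=
  ((WithLp.linearEquiv 2 ℝ _).trans ((WithLp.linearEquiv 2 ℝ _).prodCongr
    (WithLp.linearEquiv 2 ℝ _))).toContinuousLinearEquiv

/-- Multiplication by the infinite component of an idele on `𝔸_∞` with the Euclidean norm. -/
noncomputable def euclideanMul (g : (Adele K)ˣ) : EuclideanInfAdele K ≃L[ℝ] EuclideanInfAdele K :=
  ((ofEuclidean K).trans (infMul g)).trans (ofEuclidean K).symm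

theorem ofEuclidean_euclideanMul (g : (Adele K)ˣ) (x : EuclideanInfAdele K) :
    ofEuclidean K (euclideanMul g x) = (g : Adele K).1 * ofEuclidean K x :=
  (ofEuclidean K).apply_symm_apply _

theorem euclideanMul_fst (g : (Adele K)ˣ) (x : EuclideanInfAdele K) (w) :
    (euclideanMul g x).fst w = (g : Adele K).1.1 w * x.fst w :=
  congrArg (fun y : InfAdele K => y.1 w) (ofEuclidean_euclideanMul g x)

theorem euclideanMul_snd (g : (Adele K)ˣ) (x : EuclideanInfAdele K) (w) :
    (euclideanMul g x).snd w = (g : Adele K).1.2 w * x.snd w :=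
  congrArg (fun y : InfAdele K => y.2 w) (ofEuclidean_euclideanMul g x)

theorem euclidean_ext {x y : EuclideanInfAdele K} (h1 : ∀ w, x.fst w = y.fst w)
    (h2 : ∀ w, x.snd w = y.snd w) : x = y :=
  (ofEuclidean K).injective (Prod.ext (funext h1) (funext h2))

/-- Orthogonal coordinates and the Fourier transform need an inner product, while `𝔸_∞` carries a
sup norm; Schwartz spaces are transported along the linear isomorphism. -/
theorem mem_twists {χ : InfAdele K → ℂ}
    (h : ∃ A : 𝓢(EuclideanInfAdele K, ℂ) ≃L[ℂ] 𝓢(EuclideanInfAdele K, ℂ), ∀ (g : (Adele K)ˣ) f,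
      A (χ (g : Adele K).1 • pullback (euclideanMul g) f) = pullback (euclideanMul g) (A f)) :
    χ ∈ twists K := by
  obtain ⟨A, hA⟩ := h
  let P : 𝓢(InfAdele K, ℂ) →L[ℂ] 𝓢(EuclideanInfAdele K, ℂ) :=
    SchwartzMap.compCLMOfContinuousLinearEquiv ℂ (ofEuclidean K)
  let Q : 𝓢(EuclideanInfAdele K, ℂ) →L[ℂ] 𝓢(InfAdele K, ℂ) :=
    SchwartzMap.compCLMOfContinuousLinearEquiv ℂ (ofEuclidean K).symm
  have hPQ : ∀ f, P (Q f) = f := fun f => by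
    ext x
    change f ((ofEuclidean K).symm (ofEuclidean K x)) = f x
    rw [ContinuousLinearEquiv.symm_apply_apply]
  have hQP : ∀ f, Q (P f) = f := fun f => by
    ext x
    change f (ofEuclidean K ((ofEuclidean K).symm x)) = f x
    rw [ContinuousLinearEquiv.apply_symm_apply]
  have hP : ∀ g f, P (pullback (infMul g) f) = pullback (euclideanMul g) (P f) := fun g f => by
    ext x
    change f ((g : Adele K).1 * ofEuclidean K x) = f (ofEuclidean K (euclideanMul g x))
    rw [ofEuclidean_euclideanMul]
  let e := ContinuousLinearEquiv.equivOfInverse P Q hQP hPQ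
  refine Exists.intro ((e.trans A).trans e.symm) fun g f => ?_
  change Q (A (P _)) = pullback (infMul g) (Q (A (P f)))
  rw [map_smul, hP, hA, ← hQP (pullback (infMul g) (Q (A (P f)))), hP, hPQ]

open scoped Classical in
/-- The inclusion of a real coordinate. -/
noncomputable def realIncl (w : {w : InfinitePlace K // w.IsReal}) :
    ℝ →ₗᵢ[ℝ] EuclideanInfAdele K where
  toFun c := WithLp.toLp 2 (EuclideanSpace.single w c, 0)
  map_add' a b := by
    refine euclidean_ext (fun v => ?_) fun v => ?_ <;> by_cases h : v.1 = w.1 <;>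
      simp [Subtype.ext_iff, h]
  map_smul' a b := by
    refine euclidean_ext (fun v => ?_) fun v => ?_ <;> simp
  norm_map' c := by
    change ‖WithLp.toLp 2 (EuclideanSpace.single w c, 0)‖ = ‖c‖
    rw [WithLp.norm_toLp_fst, PiLp.norm_single]

open scoped Classical in
/-- The inclusion of a complex coordinate. -/
noncomputable def complexIncl (w : {w : InfinitePlace K // w.IsComplex}) :
    ℂ →ₗᵢ[ℝ] EuclideanInfAdele K where
  toFun c := WithLp.toLp 2 (0, EuclideanSpace.single w c)
  map_add' a b := by
    refine euclidean_ext (fun v => ?_) fun v => ?_ <;> by_cases h : v.1 = w.1 <;>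
      simp [Subtype.ext_iff, h]
  map_smul' a b := by
    refine euclidean_ext (fun v => ?_) fun v => ?_ <;> simp
  norm_map' c := by
    change ‖WithLp.toLp 2 (0, EuclideanSpace.single w c)‖ = ‖c‖
    rw [WithLp.norm_toLp_snd, PiLp.norm_single]

theorem coord_realIncl (w : {w : InfinitePlace K // w.IsReal}) (x : EuclideanInfAdele K) :
    coord (realIncl w) x = x.fst w := by
  classical
  refine ext_inner_left ℝ fun c => ?_
  rw [inner_coord]
  change ⟪(WithLp.toLp 2 (EuclideanSpace.single w c, 0) : EuclideanInfAdele K), x⟫ = _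
  rw [WithLp.prod_inner_apply]
  simp [EuclideanSpace.inner_single_left, mul_comm]

theorem coord_complexIncl (w : {w : InfinitePlace K // w.IsComplex}) (x : EuclideanInfAdele K) :
    coord (complexIncl w) x = x.snd w := by
  classical
  refine ext_inner_left ℝ fun c => ?_
  rw [inner_coord]
  change ⟪(WithLp.toLp 2 (0, EuclideanSpace.single w c) : EuclideanInfAdele K), x⟫ = _
  rw [WithLp.prod_inner_apply]
  refine (congrArg₂ (· + ·) (inner_zero_left _) (PiLp.inner_apply _ _)).trans ?_
  rw [zero_add, Finset.sum_eq_single w (fun v _ hv => by simp [hv]) (by simp)]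
  simp

theorem euclideanMul_realIncl (g : (Adele K)ˣ) (w : {w : InfinitePlace K // w.IsReal}) (c : ℝ) :
    euclideanMul g (realIncl w c) = realIncl w ((g : Adele K).1.1 w * c) := by
  classical
  refine euclidean_ext (fun v => ?_) fun v => ?_
  · rw [euclideanMul_fst]
    by_cases h : v = w
    · subst h; simp [realIncl]
    · simp [realIncl, h]
  · rw [euclideanMul_snd]
    simp [realIncl]

theorem euclideanMul_complexIncl (g : (Adele K)ˣ) (w : {w : InfinitePlace K // w.IsComplex})
    (c : ℂ) : euclideanMul g (complexIncl w c) = complexIncl w ((g : Adele K).1.2 w * c) := by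
  classical
  refine euclidean_ext (fun v => ?_) fun v => ?_
  · rw [euclideanMul_fst]
    simp [complexIncl]
  · rw [euclideanMul_snd]
    by_cases h : v = w
    · subst h; simp [complexIncl]
    · simp [complexIncl, h]

theorem real_mem_twists (w : {w : InfinitePlace K // w.IsReal}) :
    (fun x : InfAdele K => ((x.1 w : ℝ) : ℂ)) ∈ twists K := by
  let _ : MeasurableSpace (EuclideanInfAdele K) := borel _
  have : BorelSpace (EuclideanInfAdele K) := ⟨rfl⟩
  obtain ⟨A, hA⟩ := exists_real_twist (realIncl w)
  refine mem_twists ⟨A, fun g f => hA _ _ (euclideanMul_realIncl g w) (fun x => ?_) f⟩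
  rw [coord_realIncl, coord_realIncl, euclideanMul_fst]

theorem complex_mem_twists (w : {w : InfinitePlace K // w.IsComplex}) :
    (fun x : InfAdele K => x.2 w) ∈ twists K := by
  let _ : MeasurableSpace (EuclideanInfAdele K) := borel _
  have : BorelSpace (EuclideanInfAdele K) := ⟨rfl⟩
  obtain ⟨A, hA⟩ := exists_complex_twist (complexIncl w)
  refine mem_twists ⟨A, fun g f => hA _ _ (euclideanMul_complexIncl g w) (fun x => ?_) f⟩
  rw [coord_complexIncl, coord_complexIncl, euclideanMul_snd]

/-- Multiplication by `a` in the place's coordinate is multiplication by the conjugate of `a` in the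
conjugate coordinate, so the complex twist applies to the latter. -/
theorem conj_mem_twists (w : {w : InfinitePlace K // w.IsComplex}) :
    (fun x : InfAdele K => conj (x.2 w)) ∈ twists K := by
  let _ : MeasurableSpace (EuclideanInfAdele K) := borel _
  have : BorelSpace (EuclideanInfAdele K) := ⟨rfl⟩
  obtain ⟨A, hA⟩ := exists_complex_twist (conjEmbed (complexIncl w))
  refine mem_twists ⟨A, fun g f => hA _ _ (fun c => ?_) (fun x => ?_) f⟩
  · rw [conjEmbed_apply, conjEmbed_apply, euclideanMul_complexIncl]
    simp
  · rw [coord_conjEmbed, coord_conjEmbed, coord_complexIncl, coord_complexIncl, euclideanMul_snd,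
      map_mul]

end Twists

/-! ### Operators on `𝓢(𝔸_∞)` applied to each slice of `𝓢(𝔸_K)`. -/

section Lift

variable {K : Type*} [Field K] [IsGlobalField K]

theorem slice_eq_of_forall {f f' : BruhatSchwartz K} {y y' : FinAdele K}
    (h : ∀ x, f.1 (x, y) = f'.1 (x, y')) : slice f y = slice f' y' :=
  SchwartzMap.ext fun x => by rw [slice_apply, slice_apply, h]

theorem slice_eq_zero {f : BruhatSchwartz K} {y : FinAdele K} (h : ∀ x, f.1 (x, y) = 0) :
    slice f y = 0 :=
  SchwartzMap.ext fun x => by rw [slice_apply, h]; rfl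

theorem slice_add (f f' : BruhatSchwartz K) (y : FinAdele K) :
    slice (f + f') y = slice f y + slice f' y :=
  SchwartzMap.ext fun x => by
    rw [slice_apply, _root_.add_apply, slice_apply, slice_apply]
    rfl

theorem slice_smul (c : ℂ) (f : BruhatSchwartz K) (y : FinAdele K) :
    slice (c • f) y = c • slice f y :=
  SchwartzMap.ext fun x => by
    rw [slice_apply, _root_.smul_apply, slice_apply]
    rfl

theorem slice_ext {f f' : BruhatSchwartz K} (h : ∀ y, slice f y = slice f' y) : f = f' :=
  Subtype.ext (funext fun x => by rw [← Prod.mk.eta (p := x), ← slice_apply, h, slice_apply])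

theorem isBruhatSchwartz_slicewise (T : 𝓢(InfAdele K, ℂ) →L[ℂ] 𝓢(InfAdele K, ℂ))
    {C : Set (FinAdele K)} {U : OpenAddSubgroup (FinAdele K)} {f : BruhatSchwartz K}
    (h : IsBruhatSchwartz C U f.1) :
    IsBruhatSchwartz C U fun x : Adele K => T (slice f x.2) x.1 where
  support x y hy := by
    change T (slice f y) x = 0
    rw [slice_eq_zero fun x => h.support x y hy, map_zero]
    rfl
  invariant x y u hu := by
    change T (slice f (y + u)) x = T (slice f y) x
    rw [slice_eq_of_forall fun x => h.invariant x y u hu]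
  schwartz y := ⟨T (slice f y), fun _ => rfl⟩

/-- The operator on `𝓢(𝔸_K)` that applies an operator on `𝓢(𝔸_∞)` to each restriction to
`𝔸_∞ × {y}`. -/
noncomputable def slicewise (T : 𝓢(InfAdele K, ℂ) →L[ℂ] 𝓢(InfAdele K, ℂ)) :
    BruhatSchwartz K →ₗ[ℂ] BruhatSchwartz K where
  toFun f := ⟨fun x => T (slice f x.2) x.1, by
    obtain ⟨C, hC, U, h⟩ := f.2
    exact ⟨C, hC, U, isBruhatSchwartz_slicewise T h⟩⟩
  map_add' f f' := Subtype.ext (funext fun x => by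
    change T (slice (f + f') x.2) x.1 = T (slice f x.2) x.1 + T (slice f' x.2) x.1
    rw [slice_add, map_add]
    rfl)
  map_smul' c f := Subtype.ext (funext fun x => by
    change T (slice (c • f) x.2) x.1 = c • T (slice f x.2) x.1
    rw [slice_smul, map_smul]
    rfl)

theorem slice_slicewise (T : 𝓢(InfAdele K, ℂ) →L[ℂ] 𝓢(InfAdele K, ℂ)) (f : BruhatSchwartz K)
    (y : FinAdele K) : slice (slicewise T f) y = T (slice f y) :=
  SchwartzMap.ext fun x => by rw [slice_apply]; rfl

/-- The automorphism of `𝓢(𝔸_K)` induced by an automorphism of `𝓢(𝔸_∞)`. -/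
noncomputable def slicewiseEquiv (A : 𝓢(InfAdele K, ℂ) ≃L[ℂ] 𝓢(InfAdele K, ℂ)) :
    BruhatSchwartz K ≃ₗ[ℂ] BruhatSchwartz K :=
  LinearEquiv.ofLinearMap (slicewise A.toContinuousLinearMap)
    (slicewise A.symm.toContinuousLinearMap)
    (LinearMap.ext fun f => slice_ext fun y => by
      simp [slice_slicewise])
    (LinearMap.ext fun f => slice_ext fun y => by
      simp [slice_slicewise])

/-- The finite component of `g` only permutes the slices and the norm is a scalar, so equivariance
under the infinite component suffices. -/
theorem slice_rho (g : (Adele K)ˣ) (f : BruhatSchwartz K) (y : FinAdele K) :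
    slice (rho K g f) y =
      (ideleNorm g : ℂ) • pullback (infMul g) (slice f (y * (g : Adele K).2)) :=
  SchwartzMap.ext fun x => by
    rw [slice_apply, _root_.smul_apply, pullback_apply, slice_apply, infMul_apply, mul_comm _ x]
    rfl

theorem slicewiseEquiv_rho {A : 𝓢(InfAdele K, ℂ) ≃L[ℂ] 𝓢(InfAdele K, ℂ)} {g : (Adele K)ˣ} {c : ℂ}
    (h : ∀ f, A (c • pullback (infMul g) f) = pullback (infMul g) (A f)) (f : BruhatSchwartz K) :
    slicewiseEquiv A (c • rho K g f) = rho K g (slicewiseEquiv A f) := by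
  refine slice_ext fun y => ?_
  change slice (slicewise A.toContinuousLinearMap (c • rho K g f)) y =
    slice (rho K g (slicewise A.toContinuousLinearMap f)) y
  rw [slice_rho, slice_slicewise, slice_slicewise, slice_smul, slice_rho, smul_comm]
  change A _ = _ • pullback (infMul g) (A _)
  rw [map_smul, h]

/-- `C` and `U` are unchanged, and continuous linear maps preserve von Neumann boundedness on each
slice. -/
theorem isBounded_slicewise_image (T : 𝓢(InfAdele K, ℂ) →L[ℂ] 𝓢(InfAdele K, ℂ))
    {B : Set (BruhatSchwartz K)} (hB : @Bornology.IsBounded _ (bruhatSchwartzBornology K) B) :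
    @Bornology.IsBounded _ (bruhatSchwartzBornology K) (slicewise T '' B) := by
  rw [Bornology.isBounded_ofBounded_iff] at hB ⊢
  obtain ⟨C, hC, U, h, hb⟩ := hB
  refine ⟨C, hC, U, ?_, fun y => ?_⟩
  · rintro _ ⟨f, hf, rfl⟩
    exact isBruhatSchwartz_slicewise T (h f hf)
  · have h1 : (fun f => slice f y) '' (slicewise T '' B) = T '' ((fun f => slice f y) '' B) := by
      simp only [Set.image_image, slice_slicewise]
    rw [h1]
    exact (hb y).image T

end Lift

/-! ### Diagonal automorphisms of the tensor product. -/

section Diagonal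

variable {V W ι : Type*} [AddCommGroup V] [Module ℂ V] [AddCommGroup W] [Module ℝ W] [Finite ι]
  [DecidableEq ι]

/-- The decomposition of `V ⊗ W` defined by a basis of the complexification of `W`. -/
noncomputable def componentEquiv (b : Module.Basis ι ℂ (ℂ ⊗[ℝ] W)) : V ⊗[ℝ] W ≃ₗ[ℂ] (ι → V) :=
  ((TensorProduct.AlgebraTensorModule.cancelBaseChange ℝ ℂ ℂ V W).symm.trans
    (TensorProduct.equivFinsuppOfBasisRight b)).trans (Finsupp.linearEquivFunOnFinite ℂ V ι)

theorem componentEquiv_tmul (b : Module.Basis ι ℂ (ℂ ⊗[ℝ] W)) (v : V) (w : W) (i : ι) :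
    componentEquiv b (v ⊗ₜ w) i = b.repr (1 ⊗ₜ w) i • v := by
  simp [componentEquiv]

/-- The automorphism of `V ⊗ W` that acts by `A i` on the `i`-th component. -/
noncomputable def diagonalEquiv (b : Module.Basis ι ℂ (ℂ ⊗[ℝ] W)) (A : ι → V ≃ₗ[ℂ] V) :
    V ⊗[ℝ] W ≃ₗ[ℂ] V ⊗[ℝ] W :=
  ((componentEquiv b).trans (LinearEquiv.piCongrRight A)).trans (componentEquiv b).symm

theorem diagonalEquiv_symm (b : Module.Basis ι ℂ (ℂ ⊗[ℝ] W)) (A : ι → V ≃ₗ[ℂ] V) :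
    (diagonalEquiv b A).symm = diagonalEquiv b fun i => (A i).symm := rfl

theorem componentEquiv_diagonalEquiv (b : Module.Basis ι ℂ (ℂ ⊗[ℝ] W)) (A : ι → V ≃ₗ[ℂ] V)
    (t : V ⊗[ℝ] W) (i : ι) :
    componentEquiv b (diagonalEquiv b A t) i = A i (componentEquiv b t i) := by
  simp [diagonalEquiv]

theorem componentEquiv_tensorRep {G : Type*} [Monoid G] (σ : Representation ℂ G V)
    (τ : Representation ℝ G W) (b : Module.Basis ι ℂ (ℂ ⊗[ℝ] W)) {g : G} {χ : ι → ℂ}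
    (h : ∀ i, (τ g).baseChange ℂ (b i) = χ i • b i) (t : V ⊗[ℝ] W) (i : ι) :
    componentEquiv b (tensorRep σ τ g t) i = χ i • σ g (componentEquiv b t i) := by
  -- The dual basis of an eigenbasis consists of eigenvectors of the transposed operator, with the
  -- same eigenvalues.
  have hc : b.coord i ∘ₗ (τ g).baseChange ℂ = χ i • b.coord i := b.ext fun k => by
    rw [LinearMap.comp_apply, h, map_smul, LinearMap.smul_apply]
    by_cases hk : k = i
    · rw [hk]
    · simp [hk]
  induction t using TensorProduct.induction_on with
  | zero => simp
  | tmul v w =>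
    have := LinearMap.congr_fun hc (1 ⊗ₜ w)
    simp only [LinearMap.comp_apply, LinearMap.baseChange_tmul, LinearMap.smul_apply,
      Module.Basis.coord_apply, smul_eq_mul] at this
    change componentEquiv b (σ g v ⊗ₜ τ g w) i = _
    rw [componentEquiv_tmul, componentEquiv_tmul, this, map_smul, mul_smul]
  | add s t hs ht => simp only [map_add, Pi.add_apply, smul_add, hs, ht]

theorem diagonalEquiv_intertwines {G : Type*} [Monoid G] (σ : Representation ℂ G V)
    (τ : Representation ℝ G W) (b : Module.Basis ι ℂ (ℂ ⊗[ℝ] W)) (A : ι → V ≃ₗ[ℂ] V) {g : G}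
    {χ : ι → ℂ} (h : ∀ i, (τ g).baseChange ℂ (b i) = χ i • b i)
    (hA : ∀ i v, A i (χ i • σ g v) = σ g (A i v)) (t : V ⊗[ℝ] W) :
    diagonalEquiv b A (tensorRep σ τ g t) =
      tensorRep σ (Representation.trivial ℝ G W) g (diagonalEquiv b A t) := by
  refine (componentEquiv b).injective (funext fun i => ?_)
  rw [componentEquiv_diagonalEquiv, componentEquiv_tensorRep σ τ b h, hA,
    componentEquiv_tensorRep σ _ b (χ := 1) (fun i => ?_), componentEquiv_diagonalEquiv,
    Pi.one_apply, one_smul]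
  simp [Representation.trivial]

/-- The element is `v ⊗ b i`; expanding `b i` once gives finitely many pure tensors whose second
factors do not depend on `v`, as needed for boundedness. -/
theorem exists_componentEquiv_symm_single (b : Module.Basis ι ℂ (ℂ ⊗[ℝ] W))
    (i : ι) : ∃ s : Finset (ℂ × W), ∀ v : V,
      (componentEquiv b).symm (Pi.single i v) = ∑ p ∈ s, (p.1 • v) ⊗ₜ p.2 := by
  have hs : ∀ v : V, (componentEquiv b).symm (Pi.single i v) =
      TensorProduct.AlgebraTensorModule.cancelBaseChange ℝ ℂ ℂ V W (v ⊗ₜ b i) := fun v => by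
    rw [LinearEquiv.symm_apply_eq]
    ext k
    simp [componentEquiv, Finsupp.single_apply, Pi.single_apply, eq_comm]
  obtain ⟨s, hs'⟩ := TensorProduct.exists_finset (b i)
  refine ⟨s, fun v => ?_⟩
  rw [hs, hs', TensorProduct.tmul_sum, map_sum]
  simp

theorem absConvexHull_tensor {B : Set V} {s : Set W} {D : Set W} (hD : D ⊆ absConvexHull ℝ s) :
    tensorHull B D ⊆ tensorHull B s := by
  refine absConvexHull_min ?_ ⟨balanced_absConvexHull, convex_absConvexHull⟩
  rintro _ ⟨b, hb, d, hd, rfl⟩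
  have h1 : absConvexHull ℝ s ⊆ TensorProduct.mk ℝ V W b ⁻¹' tensorHull B s := by
    refine absConvexHull_min (fun w hw => subset_absConvexHull ⟨b, hb, w, hw, rfl⟩) ⟨?_, ?_⟩
    · rintro a ha _ ⟨x, hx, rfl⟩
      change b ⊗ₜ (a • x) ∈ tensorHull B s
      rw [TensorProduct.tmul_smul]
      exact balanced_absConvexHull a ha ⟨_, hx, rfl⟩
    · exact convex_absConvexHull.linear_preimage _
  exact h1 (hD hd)

end Diagonal

/-! ### An eigenbasis of the complexified exterior algebra. -/

section Eigenvectors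

open NumberField

variable {K : Type*} [Field K]

theorem piRep_ι (g : (Adele K)ˣ) (x : InfAdele K) :
    piRep K g (ExteriorAlgebra.ι ℝ x) = ExteriorAlgebra.ι ℝ ((g : Adele K).1 * x) :=
  ExteriorAlgebra.map_apply_ι _ _

open scoped Classical in
theorem mul_complexSingle (x : InfAdele K) (w : {w : InfinitePlace K // w.IsComplex}) (c : ℂ) :
    x * ((0, Pi.single w c) : InfAdele K) =
      (x.2 w * c).re • ((0, Pi.single w 1) : InfAdele K) +
        (x.2 w * c).im • ((0, Pi.single w Complex.I) : InfAdele K) := by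
  refine Prod.ext (funext fun v => ?_) (funext fun v => ?_)
  · simp
  · by_cases hv : v = w
    · subst hv
      simpa using (Complex.re_add_im (x.2 v * c)).symm
    · simp [hv]

variable [IsGlobalField K]

variable (K) in
/-- The simultaneous eigenvectors in the complexification of `Λ𝔸_∞` whose character is a twist. -/
noncomputable def eigenvectors : Submonoid (ℂ ⊗[ℝ] ExtInf K) where
  carrier := {u | ∃ χ ∈ twists K, ∀ g : (Adele K)ˣ,
    (piRep K g).baseChange ℂ u = χ (g : Adele K).1 • u}
  one_mem' := ⟨1, one_mem _, fun g => by
    rw [Algebra.TensorProduct.one_def, LinearMap.baseChange_tmul, Pi.one_apply, one_smul]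
    exact congrArg _ (map_one (ExteriorAlgebra.map (LinearMap.mulLeft ℝ (g : Adele K).1)))⟩
  mul_mem' := by
    rintro u v ⟨χ, hχ, hu⟩ ⟨ψ, hψ, hv⟩
    refine ⟨χ * ψ, mul_mem hχ hψ, fun g => ?_⟩
    have h : ∀ x y, (piRep K g).baseChange ℂ (x * y) =
        (piRep K g).baseChange ℂ x * (piRep K g).baseChange ℂ y :=
      map_mul (Algebra.TensorProduct.map (AlgHom.id ℂ ℂ)
        (ExteriorAlgebra.map (LinearMap.mulLeft ℝ (g : Adele K).1)))
    rw [h, hu, hv, smul_mul_smul_comm, Pi.mul_apply]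

open scoped Classical in
theorem real_mem_eigenvectors (w : {w : InfinitePlace K // w.IsReal}) :
    1 ⊗ₜ ExteriorAlgebra.ι ℝ ((Pi.single w 1, 0) : InfAdele K) ∈ eigenvectors K := by
  refine ⟨_, real_mem_twists w, fun g => ?_⟩
  have h : (g : Adele K).1 * ((Pi.single w 1, 0) : InfAdele K) =
      (g : Adele K).1.1 w • ((Pi.single w 1, 0) : InfAdele K) := by
    refine Prod.ext (funext fun v => ?_) (funext fun v => ?_)
    · by_cases hv : v = w
      · subst hv; simp
      · simp [hv]
    · simp
  rw [LinearMap.baseChange_tmul, piRep_ι, h, map_smul, TensorProduct.tmul_smul,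
    TensorProduct.smul_tmul', TensorProduct.smul_tmul', Complex.real_smul, smul_eq_mul]

open scoped Classical in
/-- The eigenvectors `1 ⊗ [1] + ε I ⊗ [I]` at a complex place, where `ε = ± 1`. -/
theorem complex_mem_eigenvectors (w : {w : InfinitePlace K // w.IsComplex}) (ε : ℂ)
    (hε : ε = 1 ∨ ε = -1) :
    1 ⊗ₜ ExteriorAlgebra.ι ℝ ((0, Pi.single w 1) : InfAdele K) +
      (ε * Complex.I) ⊗ₜ ExteriorAlgebra.ι ℝ ((0, Pi.single w Complex.I) : InfAdele K)
        ∈ eigenvectors K := by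
  -- For `ε = 1` the character is the conjugate of the coordinate, for `ε = -1` the coordinate
  -- itself.
  have hmem : (fun x : InfAdele K => ((x.2 w).re : ℂ) - ε * Complex.I * (x.2 w).im) ∈ twists K := by
    rcases hε with rfl | rfl
    · convert conj_mem_twists w using 2 with x
      apply Complex.ext <;> simp
    · convert complex_mem_twists w using 2 with x
      apply Complex.ext <;> simp
  refine ⟨_, hmem, fun g => ?_⟩
  rw [map_add, LinearMap.baseChange_tmul, LinearMap.baseChange_tmul, piRep_ι, piRep_ι,
    mul_complexSingle, mul_complexSingle _ _ Complex.I]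
  generalize (g : Adele K).1.2 w = a
  simp only [map_add, map_smul, TensorProduct.tmul_add, TensorProduct.tmul_smul,
    TensorProduct.smul_tmul', smul_add, smul_eq_mul, mul_one, Complex.mul_I_re, Complex.mul_I_im,
    Complex.real_smul]
  have h2 : ε * ε = 1 := by rcases hε with rfl | rfl <;> norm_num
  have e1 : ((a.re : ℂ) - ε * Complex.I * a.im) = a.re + (-a.im : ℝ) * (ε * Complex.I) := by
    push_cast; ring
  have e2 : ((a.re : ℂ) - ε * Complex.I * a.im) * (ε * Complex.I) = a.im + a.re * (ε * Complex.I) := by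
    linear_combination -(a.im : ℂ) * ε ^ 2 * Complex.I_sq + a.im * h2
  rw [e2, e1, TensorProduct.add_tmul, TensorProduct.add_tmul]
  abel

/-- Eigenvectors are closed under products, so their span is a subalgebra. It contains the
generators: at a complex place, sum and difference of the two eigenvectors recover `1` and `I`. -/
theorem span_eigenvectors : Submodule.span ℂ (eigenvectors K : Set (ℂ ⊗[ℝ] ExtInf K)) = ⊤ := by
  classical
  let S : Subalgebra ℂ (ℂ ⊗[ℝ] ExtInf K) := Algebra.adjoin ℂ (eigenvectors K)
  have hS : Subalgebra.toSubmodule S = Submodule.span ℂ (eigenvectors K) := by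
    rw [Algebra.adjoin_eq_span, Submonoid.closure_eq]
  have hE : ∀ u ∈ eigenvectors K, u ∈ S := fun u hu => Algebra.subset_adjoin hu
  have hι : ∀ x : InfAdele K, (1 : ℂ) ⊗ₜ[ℝ] ExteriorAlgebra.ι ℝ x ∈ S := by
    let N : Submodule ℝ (InfAdele K) := (Subalgebra.toSubmodule S).restrictScalars ℝ |>.comap
      ((TensorProduct.mk ℝ ℂ (ExtInf K) 1) ∘ₗ ExteriorAlgebra.ι ℝ)
    have hc : ∀ w : {w : InfinitePlace K // w.IsComplex}, ∀ c : ℂ, c = 1 ∨ c = Complex.I →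
        ((0, Pi.single w c) : InfAdele K) ∈ N := by
      intro w c hc
      have h1 := hE _ (complex_mem_eigenvectors w 1 (Or.inl rfl))
      have h2 := hE _ (complex_mem_eigenvectors w (-1) (Or.inr rfl))
      rcases hc with rfl | rfl
      · have h3 := S.smul_mem (S.add_mem h1 h2) (1 / 2)
        change (1 : ℂ) ⊗ₜ[ℝ] ExteriorAlgebra.ι ℝ ((0, Pi.single w 1) : InfAdele K) ∈ S
        convert h3 using 1
        simp only [TensorProduct.neg_tmul, neg_mul, one_mul]
        module
      · have h3 := S.smul_mem (S.sub_mem h1 h2) (-Complex.I / 2)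
        have h4 : ∀ y : ExtInf K, Complex.I ⊗ₜ[ℝ] y = Complex.I • ((1 : ℂ) ⊗ₜ[ℝ] y) := fun y => by
          rw [TensorProduct.smul_tmul', smul_eq_mul, mul_one]
        change (1 : ℂ) ⊗ₜ[ℝ] ExteriorAlgebra.ι ℝ ((0, Pi.single w Complex.I) : InfAdele K) ∈ S
        convert h3 using 1
        simp only [TensorProduct.neg_tmul, neg_mul, one_mul, h4]
        match_scalars
        · linear_combination Complex.I_sq
        · ring
    have hN : ∀ x, x ∈ N := fun x => by
      have hx : x = ∑ w, x.1 w • ((Pi.single w 1, 0) : InfAdele K) +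
          ∑ w, ((x.2 w).re • ((0, Pi.single w 1) : InfAdele K) +
            (x.2 w).im • ((0, Pi.single w Complex.I) : InfAdele K)) := by
        refine Prod.ext (funext fun v => ?_) (funext fun v => ?_)
        · simp [Prod.fst_sum, Finset.sum_apply, Pi.single_apply]
        · simp [Prod.snd_sum, Finset.sum_apply, Pi.single_apply, Finset.sum_add_distrib]
      rw [hx]
      exact N.add_mem (N.sum_mem fun w _ => N.smul_mem _ (hE _ (real_mem_eigenvectors w)))
        (N.sum_mem fun w _ => N.add_mem (N.smul_mem _ (hc w _ (Or.inl rfl)))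
          (N.smul_mem _ (hc w _ (Or.inr rfl))))
    exact hN
  have hΛ : ∀ a : ExtInf K, (1 : ℂ) ⊗ₜ[ℝ] a ∈ S := fun a => by
    induction a using ExteriorAlgebra.induction with
    | algebraMap r =>
      rw [Algebra.algebraMap_eq_smul_one, TensorProduct.tmul_smul]
      exact (Subalgebra.toSubmodule S).restrictScalars ℝ |>.smul_mem r S.one_mem
    | ι x => exact hι x
    | mul a b ha hb =>
      have := S.mul_mem ha hb
      rwa [Algebra.TensorProduct.tmul_mul_tmul, one_mul] at this
    | add a b ha hb =>
      rw [TensorProduct.tmul_add]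
      exact S.add_mem ha hb
  rw [← hS, eq_top_iff]
  intro u hu
  clear hu
  induction u using TensorProduct.induction_on with
  | zero => exact S.zero_mem
  | tmul z a =>
    have := S.smul_mem (hΛ a) z
    rwa [TensorProduct.smul_tmul', smul_eq_mul, mul_one] at this
  | add u v hu hv => exact S.add_mem hu hv

theorem exists_eigenbasis : ∃ (n : ℕ) (b : Module.Basis (Fin n) ℂ (ℂ ⊗[ℝ] ExtInf K)),
    ∀ i, b i ∈ eigenvectors K := by
  classical
  -- The basis of the exterior algebra needs some order on the index set; any will do.
  let _ : LinearOrder (Module.Free.ChooseBasisIndex ℝ (InfAdele K)) := linearOrderOfSTO WellOrderingRel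
  have : Module.Finite ℝ (ExtInf K) := Module.Finite.of_basis
    (Module.Free.chooseBasis ℝ (InfAdele K)).ExteriorAlgebra
  obtain ⟨s, hs, hs', hs''⟩ := exists_linearIndependent ℂ (eigenvectors K : Set (ℂ ⊗[ℝ] ExtInf K))
  let b : Module.Basis s ℂ (ℂ ⊗[ℝ] ExtInf K) := Module.Basis.mk hs'' (by
    rw [Subtype.range_coe, hs', span_eigenvectors])
  have : Finite s := Module.Finite.finite_basis b
  refine ⟨_, b.reindex (Finite.equivFin s), fun i => ?_⟩
  rw [Module.Basis.reindex_apply, Module.Basis.mk_apply]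
  exact hs (Subtype.coe_prop _)

end Eigenvectors

/-! ### Bounded subsets of `𝓢(𝔸_K) ⊗ Λ𝔸_∞`. -/

section Boundedness

variable {K : Type*} [Field K] [IsGlobalField K]

theorem isBounded_schwartzForms_iff {T : Set (SchwartzForms K)} : Bornology.IsBounded T ↔
    ∃ B, @Bornology.IsBounded _ (bruhatSchwartzBornology K) B ∧
      ∃ s : Set (ExtInf K), s.Finite ∧ T ⊆ tensorHull B s := by
  rw [Bornology.isBounded_def]
  refine Iff.trans Filter.compl_mem_comk ?_
  constructor
  · rintro ⟨B, hB, D, hD, hT⟩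
    rw [Bornology.isBounded_ofBounded_iff] at hD
    obtain ⟨s, hs, hD⟩ := hD
    exact ⟨B, hB, s, hs, hT.trans (absConvexHull_tensor hD)⟩
  · rintro ⟨B, hB, s, hs, hT⟩
    exact ⟨B, hB, s, @Set.Finite.isBounded _ (fineBornology _) _ hs, hT⟩

theorem isBounded_absConvexHull {T : Set (SchwartzForms K)} (hT : Bornology.IsBounded T) :
    Bornology.IsBounded (absConvexHull ℝ T) := by
  rw [isBounded_schwartzForms_iff] at hT ⊢
  obtain ⟨B, hB, s, hs, hT⟩ := hT
  exact ⟨B, hB, s, hs, absConvexHull_min hT ⟨balanced_absConvexHull, convex_absConvexHull⟩⟩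

theorem isBounded_two_smul {B : Set (BruhatSchwartz K)}
    (hB : @Bornology.IsBounded _ (bruhatSchwartzBornology K) B) :
    @Bornology.IsBounded _ (bruhatSchwartzBornology K) ((fun b => (2 : ℝ) • b) '' B) := by
  have h : (fun b : BruhatSchwartz K => (2 : ℝ) • b) =
      slicewise ((2 : ℂ) • ContinuousLinearMap.id ℂ _) := funext fun f => slice_ext fun y => by
    rw [slice_slicewise]
    refine (slice_smul ((2 : ℝ) : ℂ) f y).trans ?_
    simp
  rw [h]
  exact isBounded_slicewise_image _ hB

theorem isBounded_image_add {X : Type*} {F G : X → SchwartzForms K} {B : Set X}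
    (hF : Bornology.IsBounded (F '' B)) (hG : Bornology.IsBounded (G '' B)) :
    Bornology.IsBounded ((fun x => F x + G x) '' B) := by
  rw [isBounded_schwartzForms_iff] at hF hG ⊢
  obtain ⟨C, hC, s, hs, hF⟩ := hF
  obtain ⟨C', hC', s', hs', hG⟩ := hG
  -- `F x + G x` is the midpoint of `2 F x` and `2 G x`, which lie in the hull of the doubled union.
  refine ⟨_, isBounded_two_smul ((Bornology.isBounded_union).2 ⟨hC, hC'⟩), _, hs.union hs', ?_⟩
  rintro _ ⟨x, hx, rfl⟩
  have h1 := two_smul_mem_tensorHull (tensorHull_mono (Set.subset_union_left (t := C'))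
    (Set.subset_union_left (t := s')) (hF ⟨x, hx, rfl⟩))
  have h2 := two_smul_mem_tensorHull (tensorHull_mono (Set.subset_union_right (s := C))
    (Set.subset_union_right (s := s)) (hG ⟨x, hx, rfl⟩))
  have := convex_absConvexHull h1 h2 (a := 1 / 2) (b := 1 / 2) (by norm_num) (by norm_num)
    (by norm_num)
  simpa [tensorHull, smul_smul] using this

theorem isBounded_image_sum {X ι : Type*} {F : ι → X → SchwartzForms K} {B : Set X}
    (s : Finset ι) (hF : ∀ i ∈ s, Bornology.IsBounded (F i '' B)) :
    Bornology.IsBounded ((fun x => ∑ i ∈ s, F i x) '' B) := by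
  classical
  induction s using Finset.induction_on with
  | empty =>
    refine Bornology.IsBounded.subset (Set.finite_singleton (0 : SchwartzForms K)).isBounded ?_
    rintro _ ⟨x, -, rfl⟩
    simp
  | insert i s hi ih =>
    simp only [Finset.sum_insert hi]
    exact isBounded_image_add (hF i (Finset.mem_insert_self i s))
      (ih fun k hk => hF k (Finset.mem_insert_of_mem hk))

/-- Preimages of absolutely convex sets under linear maps are absolutely convex, so only pure
tensors with finitely many second factors matter. -/
theorem isBounded_image_of_tmul (Φ : SchwartzForms K →ₗ[ℂ] SchwartzForms K)
    (h : ∀ B, @Bornology.IsBounded _ (bruhatSchwartzBornology K) B → ∀ w,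
      Bornology.IsBounded ((fun f : BruhatSchwartz K => Φ (f ⊗ₜ w)) '' B))
    {T : Set (SchwartzForms K)} (hT : Bornology.IsBounded T) : Bornology.IsBounded (Φ '' T) := by
  obtain ⟨B, hB, s, hs, hT⟩ := isBounded_schwartzForms_iff.1 hT
  have h1 : Bornology.IsBounded (⋃ w ∈ s, (fun f : BruhatSchwartz K => Φ (f ⊗ₜ w)) '' B) :=
    (Bornology.isBounded_biUnion hs).2 fun w _ => h B hB w
  refine (isBounded_absConvexHull h1).subset (Set.image_subset_iff.2 (hT.trans ?_))
  refine absConvexHull_min ?_ ⟨?_, ?_⟩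
  · rintro _ ⟨b, hb, w, hw, rfl⟩
    exact subset_absConvexHull (Set.mem_biUnion hw ⟨b, hb, rfl⟩)
  · rintro a ha _ ⟨x, hx, rfl⟩
    have h2 : Φ (a • x) = a • Φ x := (Φ.restrictScalars ℝ).map_smul a x
    change Φ (a • x) ∈ absConvexHull ℝ _
    rw [h2]
    exact balanced_absConvexHull a ha ⟨_, hx, rfl⟩
  · exact convex_absConvexHull.linear_preimage (Φ.restrictScalars ℝ)

theorem isBounded_diagonalEquiv_image {ι : Type*} [Fintype ι] [DecidableEq ι]
    (b : Module.Basis ι ℂ (ℂ ⊗[ℝ] ExtInf K)) (A : ι → 𝓢(InfAdele K, ℂ) ≃L[ℂ] 𝓢(InfAdele K, ℂ))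
    {T : Set (SchwartzForms K)} (hT : Bornology.IsBounded T) :
    Bornology.IsBounded (diagonalEquiv b (fun i => slicewiseEquiv (A i)) '' T) := by
  refine isBounded_image_of_tmul (diagonalEquiv b fun i => slicewiseEquiv (A i)).toLinearMap
    (fun B hB w => ?_) hT
  choose s hs using exists_componentEquiv_symm_single (V := BruhatSchwartz K) b
  have h1 : ∀ f : BruhatSchwartz K, diagonalEquiv b (fun i => slicewiseEquiv (A i)) (f ⊗ₜ w) =
      ∑ i, ∑ p ∈ s i, (p.1 • slicewise (A i : 𝓢(InfAdele K, ℂ) →L[ℂ] 𝓢(InfAdele K, ℂ))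
        (b.repr (1 ⊗ₜ w) i • f)) ⊗ₜ p.2 := fun f => by
    simp only [← hs]
    rw [← map_sum, diagonalEquiv, LinearEquiv.trans_apply]
    refine congrArg _ (funext fun k => ?_)
    rw [Finset.sum_apply, Finset.sum_pi_single]
    simp only [Finset.mem_univ, if_true]
    exact congrArg (slicewiseEquiv (A k)) (componentEquiv_tmul b f w k)
  change Bornology.IsBounded ((fun f => diagonalEquiv b _ (f ⊗ₜ w)) '' B)
  simp only [h1]
  refine isBounded_image_sum _ fun i _ => isBounded_image_sum _ fun p _ => ?_
  refine isBounded_schwartzForms_iff.2 ⟨_, isBounded_slicewise_image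
    ((p.1 * b.repr (1 ⊗ₜ w) i) • (A i : 𝓢(InfAdele K, ℂ) →L[ℂ] 𝓢(InfAdele K, ℂ))) hB, {p.2},
    Set.finite_singleton _, ?_⟩
  rintro _ ⟨f, hf, rfl⟩
  refine subset_absConvexHull ⟨_, ⟨f, hf, rfl⟩, p.2, rfl, ?_⟩
  refine congrArg (· ⊗ₜ p.2) (slice_ext fun y => ?_)
  rw [slice_slicewise, slice_smul, slice_slicewise, slice_smul, _root_.smul_apply, map_smul,
    mul_smul]

theorem slicewiseEquiv_symm (A : 𝓢(InfAdele K, ℂ) ≃L[ℂ] 𝓢(InfAdele K, ℂ)) :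
    (slicewiseEquiv A).symm = slicewiseEquiv A.symm := LinearEquiv.ext fun _ => rfl

end Boundedness

end GlobalAdele

theorem lemma4p1 (K : Type*) [Field K] [GlobalAdele.IsGlobalField K] :
    ∃ Φ : GlobalAdele.SchwartzForms K ≃ₗ[ℂ] GlobalAdele.SchwartzForms K,
      (∀ T : Set (GlobalAdele.SchwartzForms K),
        Bornology.IsBounded (Φ '' T) ↔ Bornology.IsBounded T) ∧
      ∀ (g : (GlobalAdele.Adele K)ˣ) (ω : GlobalAdele.SchwartzForms K),
        Φ (GlobalAdele.tensorRep (GlobalAdele.rho K) (GlobalAdele.piRep K) g ω) =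
          GlobalAdele.tensorRep (GlobalAdele.rho K)
            (Representation.trivial ℝ (GlobalAdele.Adele K)ˣ (GlobalAdele.ExtInf K)) g (Φ ω) := by
  obtain ⟨n, b, hb⟩ := GlobalAdele.exists_eigenbasis (K := K)
  choose χ hχ hbχ using hb
  choose A hA using hχ
  refine ⟨GlobalAdele.diagonalEquiv b fun i => GlobalAdele.slicewiseEquiv (A i),
    fun T => ⟨fun hT => ?_, GlobalAdele.isBounded_diagonalEquiv_image b A⟩,
    fun g => GlobalAdele.diagonalEquiv_intertwines _ _ b _ (fun i => hbχ i g)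
      fun i => GlobalAdele.slicewiseEquiv_rho (hA i g)⟩
  -- The inverse is the diagonal automorphism of the inverse twists, so it also preserves bounded
  -- sets.
  have h := GlobalAdele.isBounded_diagonalEquiv_image b (fun i => (A i).symm) hT
  rw [Set.image_image] at h
  refine h.subset fun t ht => ⟨t, ht, ?_⟩
  simp only [← GlobalAdele.slicewiseEquiv_symm, ← GlobalAdele.diagonalEquiv_symm,
    LinearEquiv.symm_apply_apply]
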